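/- Let $M\ge 1$, $\mathcal X=\mathcal X_1\times\dots\times\mathcal X_M$ with $\mathcal X_m=\mathbb R^{d_m}$, and write $x_{-m}$ for $x\in\mathcal X$ with its $m$-th block removed. Let $\pi$ be a probability measure on $\mathcal X$ satisfying the following block assumption: $\pi(\mathrm dx)=\exp(-U(x))\,\mathrm dx$, where $$U(x)=U_0(x)+\sum_{m=1}^M U_m(x_m),$$ each $U_m:\mathbb R^{d_m}\to\mathbb R$ is convex, $U_0:\mathcal X\to\mathbb R$ is of class $C^1$, and there are constants $L_1,\dots,L_M>0$ and $\lambda^*>0$ such that (i) for every $m$ and every $\bar x_{-m}$, the map $x_m\mapsto\nabla_m U_0(x_m,\bar x_{-m})$ is $L_m$-Lipschitz (Euclidean norm on $\mathbb R^{d_m}$); (ii) $x\mapsto U_0(x)-\frac{\lambda^*}{2}\sum_{m=1}^M L_m\|x_m\|^2$ is convex on $\mathcal X$. Put $\kappa^*=1/\lambda^*$. Let $P^{\mathrm{GS}}=\frac1M\sum_{m=1}^M P_m$ be the random scan Gibbs sampler kernel, where $P_m(x,A)=\int_{\mathcal X_m}\mathbf 1_A(y_m,x_{-m})\,\pi(\mathrm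 dy_m\mid x_{-m})$ and $\pi(\cdot\mid x_{-m})$ is the conditional distribution of $X_m$ given $X_{-m}=x_{-m}$ for $X\sim\pi$. Define the spectral gap $$\mathrm{Gap}(P^{\mathrm{GS}})=\inf_{f\in L^2(\pi),\ \mathrm{Var}_\pi(f)>0}\frac{\langle f,(\mathrm{Id}-P^{\mathrm{GS}})f\rangle_{L^2(\pi)}}{\mathrm{Var}_\pi(f)}$$ in the extended reals (real-valued $f$; $\inf\emptyset=+\infty$), where $P^{\mathrm{GS}}f(x)=\int f(y)\,P^{\mathrm{GS}}(x,\mathrm dy)$. Then $$\mathrm{Gap}(P^{\mathrm{GS}})\ge\frac{1}{2\kappa^*M}.$$ Equivalently, if $X\sim\pi$ and $f\in L^2(\pi)$, then $$\sum_{m=1}^M\mathbb E\big(\mathrm{Var}(f(X)\mid X_{-m})\big)\ \ge\ \frac{1}{2\kappa^*}\,\mathrm{Var}(f(X)).$$ -/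

import Mathlib

open MeasureTheory ProbabilityTheory
open scoped ENNReal NNReal

noncomputable section

namespace GibbsSampler

/-- The state space `ℝ^{d₁} × ⋯ × ℝ^{d_M}`; each block carries its Euclidean norm, the product
carries the Borel σ-algebra and Lebesgue measure (the product `volume`). -/
abbrev State {M : ℕ} (d : Fin M → ℕ) : Type :=
  (m : Fin M) → EuclideanSpace ℝ (Fin (d m))

/-- The space of the components `x_{-m}`. -/
abbrev StateCompl {M : ℕ} (d : Fin M → ℕ) (m : Fin M) : Type :=
  (i : {i : Fin M // i ≠ m}) → EuclideanSpace ℝ (Fin (d i))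

/-- The projection `x ↦ x_{-m}`, forgetting the `m`-th block. -/
def dropBlock {M : ℕ} {d : Fin M → ℕ} (m : Fin M) (x : State d) : StateCompl d m :=
  fun i => x i

theorem measurable_dropBlock {M : ℕ} {d : Fin M → ℕ} (m : Fin M) :
    Measurable (dropBlock (d := d) m) :=
  measurable_pi_lambda _ fun i => measurable_pi_apply (i : Fin M)

/-- The squared norm `‖x‖_L² = ∑ₘ Lₘ ‖xₘ‖²`. -/
def weightedNormSq {M : ℕ} {d : Fin M → ℕ} (L : Fin M → ℝ≥0) (x : State d) : ℝ :=
  ∑ m, (L m : ℝ) * ‖x m‖ ^ 2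

/-- The potential `U` decomposes as `U(x) = U₀(x) + ∑ₘ Vₘ(xₘ)` with each `Vₘ` convex and `U₀` of
class `C¹`, block-wise smooth with constants `Lₘ > 0`, and `lam`-convex for `‖·‖_L`. -/
structure IsBlockConvexSmooth {M : ℕ} {d : Fin M → ℕ} (U U₀ : State d → ℝ)
    (V : (m : Fin M) → EuclideanSpace ℝ (Fin (d m)) → ℝ) (L : Fin M → ℝ≥0) (lam : ℝ) : Prop where
  decomp : ∀ x, U x = U₀ x + ∑ m, V m (x m)
  convex_block : ∀ m, ConvexOn ℝ Set.univ (V m)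
  contDiff : ContDiff ℝ 1 U₀
  const_pos : ∀ m, 0 < L m
  /-- `xₘ ↦ ∇ₘ U₀(xₘ, x_{-m})` is `Lₘ`-Lipschitz, whatever the other blocks. -/
  smooth : ∀ (m : Fin M) (x : State d),
    LipschitzWith (L m) (gradient fun y => U₀ (Function.update x m y))
  lam_pos : 0 < lam
  strong_convex : ConvexOn ℝ Set.univ fun x => U₀ x - lam / 2 * weightedNormSq L x

/-- The measure `exp(-U(x)) dx`. -/
def gibbsMeasure {M : ℕ} {d : Fin M → ℕ} (U : State d → ℝ) : Measure (State d) :=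
  volume.withDensity fun x => ENNReal.ofReal (Real.exp (-U x))

/-- The block assumption on the probability measure `π`, with convexity constant `lam` (called `λ*`):
`π = exp(-U)`, with `U` as in `IsBlockConvexSmooth` for some decomposition and constants `Lₘ`. -/
def BlockAssumption {M : ℕ} {d : Fin M → ℕ} (π : Measure (State d)) [IsProbabilityMeasure π]
    (lam : ℝ) : Prop :=
  ∃ (U U₀ : State d → ℝ) (V : (m : Fin M) → EuclideanSpace ℝ (Fin (d m)) → ℝ) (L : Fin M → ℝ≥0),
    π = gibbsMeasure U ∧ IsBlockConvexSmooth U U₀ V L lam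

/-- The coordinate-wise condition number `κ* = 1 / λ*`. -/
def coordCondNumber (lam : ℝ) : ℝ := 1 / lam

/-- The full conditional `π(· | x_{-m})`: the regular conditional distribution of the block `Xₘ`
given `X_{-m}`, for `X ∼ π`. -/
def fullConditional {M : ℕ} {d : Fin M → ℕ} (π : Measure (State d)) [IsProbabilityMeasure π]
    (m : Fin M) : Kernel (StateCompl d m) (EuclideanSpace ℝ (Fin (d m))) :=
  condDistrib (fun x : State d => x m) (dropBlock m) π

theorem measurable_updateBlock {M : ℕ} {d : Fin M → ℕ} (m : Fin M) :
    Measurable fun p : State d × EuclideanSpace ℝ (Fin (d m)) => Function.update p.1 m p.2 := by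
  refine measurable_pi_lambda _ fun i => ?_
  by_cases h : i = m
  · subst h
    simpa using measurable_snd
  · simp only [Function.update_of_ne h]
    exact (measurable_pi_apply i).comp measurable_fst

/-- The kernel `Pₘ`: `Pₘ(x, ·)` is the law of `(yₘ, x_{-m})` with `yₘ ∼ π(· | x_{-m})`. -/
def blockKernel {M : ℕ} {d : Fin M → ℕ} (π : Measure (State d)) [IsProbabilityMeasure π]
    (m : Fin M) : Kernel (State d) (State d) :=
  (Kernel.id ×ₖ (fullConditional π m).comap (dropBlock m) (measurable_dropBlock m)).map
    fun p => Function.update p.1 m p.2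

/-- The kernel `Pₘ` is the usual one: `Pₘ(x, A) = ∫ 1_A(yₘ, x_{-m}) π(dy | x_{-m})`. -/
theorem blockKernel_apply {M : ℕ} {d : Fin M → ℕ} (π : Measure (State d)) [IsProbabilityMeasure π]
    (m : Fin M) (x : State d) {A : Set (State d)} (hA : MeasurableSet A) :
    blockKernel π m x A =
      ∫⁻ y, A.indicator 1 (Function.update x m y) ∂(fullConditional π m (dropBlock m x)) := by
  have hu : Measurable fun y : EuclideanSpace ℝ (Fin (d m)) => Function.update x m y :=
    (measurable_updateBlock m).comp measurable_prodMk_left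
  have : IsMarkovKernel (fullConditional π m) := by
    unfold fullConditional
    infer_instance
  rw [blockKernel, Kernel.map_apply _ (measurable_updateBlock m), Kernel.prod_apply,
    Kernel.id_apply, Kernel.comap_apply, Measure.dirac_prod,
    Measure.map_map (measurable_updateBlock m) measurable_prodMk_left,
    Measure.map_apply ((measurable_updateBlock m).comp measurable_prodMk_left) hA]
  exact (lintegral_indicator_one (hu hA)).symm

/-- The random scan Gibbs sampler kernel `P^GS = M⁻¹ ∑ₘ Pₘ`. -/
def gibbsKernel {M : ℕ} {d : Fin M → ℕ} (π : Measure (State d)) [IsProbabilityMeasure π] :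
    Kernel (State d) (State d) where
  toFun x := (M : ℝ≥0∞)⁻¹ • ∑ m, blockKernel π m x
  measurable' := by
    refine Measure.measurable_of_measurable_coe _ fun s hs => ?_
    simp only [Measure.smul_apply, Measure.finsetSum_apply, smul_eq_mul]
    exact (Finset.measurable_sum _ fun m _ => (blockKernel π m).measurable_coe hs).const_mul _

/-- The Dirichlet form `⟨f, (Id - P) f⟩_{L²(π)}`, where `P f (x) = ∫ f(y) P(x, dy)`. -/
def dirichletForm {S : Type*} [MeasurableSpace S] (π : Measure S) (P : Kernel S S)
    (f : S → ℝ) : ℝ :=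
  ∫ x, f x * (f x - ∫ y, f y ∂(P x)) ∂π

/-- The spectral gap: the infimum of `⟨f, (Id - P) f⟩_{L²(π)} / Var_π(f)` over the `f ∈ L²(π)` for
which the quotient makes sense, that is, those with nonzero variance. -/
def spectralGap {S : Type*} [MeasurableSpace S] (π : Measure S) (P : Kernel S S) : EReal :=
  ⨅ (f : S → ℝ) (_ : MemLp f 2 π) (_ : 0 < Var[f; π]),
    ((dirichletForm π P f / Var[f; π] : ℝ) : EReal)

/-- The σ-algebra generated by `X_{-m}`. -/
abbrev sigmaDrop {M : ℕ} {d : Fin M → ℕ} {Ω : Type*} (X : Ω → State d) (m : Fin M) :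
    MeasurableSpace Ω :=
  MeasurableSpace.comap (fun ω => dropBlock m (X ω)) inferInstance

end GibbsSampler

end

/-! The core is an entropy inequality obtained by transport. Let h be a density with respect to π
and, for each m, let g_m be a density that does not depend on x_m. The Knothe-Rosenblatt map T from
hπ to π (`exists_triangular_transport`) is assembled one coordinate at a time from monotone maps of
the line. Its Jacobian is triangular, so the determinant factors over the blocks as ∏ D_m. Moving
block m alone by the fraction lam, S_m(x) = (x_{-m}, (1 - lam) x_m + lam T_m(x)), has Jacobian at
least D_m^lam by the arithmetic-geometric inequality. Since g_m ∘ S_m = g_m, the weight w_m = g_m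
D_m^lam exp(U - U ∘ S_m) has π-integral at most 1.

Block smoothness and convexity give ∑ U(S_m x) ≤ M U(x) + lam (U(Tx) - U(x)) (`sum_update_le`), and
the Jacobian equation gives ∑ log D_m = log h - U + U ∘ T. Together, ∑ log g_m - (M - lam) log h ≤ ∑
log(w_m / h). Integrating against h and using log r ≤ r - 1 yields ∑ ∫ h log g_m dπ ≤ (M - lam) ∫ h
log h dπ (`sum_integral_mul_log_le`).

Take h = 1 + εf and g_m = 1 + ε E[f | X_{-m}] with f centred, bounded and continuous. The terms of
order ε² say that ∑ E(E[f | X_{-m}]²) ≤ (M - lam) E f², that is, ∑ E Var(f | X_{-m}) ≥ lam Var f.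
Density extends this to L², and the Dirichlet form of the sampler is 1/M times the left side. The
constant obtained is lam, twice what is claimed. -/

namespace GibbsSampler

/-! ### Monotone transport on the line -/

section OneDimensional

/-- Strict differentiability, rather than mere differentiability, is what the local inverse in
`hasDerivAt_monotone_transport` requires. -/
theorem hasStrictDerivAt_integral_Iic {p : ℝ → ℝ} (hp : Continuous p) (hi : Integrable p) (s : ℝ) :
    HasStrictDerivAt (fun y => ∫ u in Set.Iic y, p u) (p s) s := by
  have h1 : HasStrictDerivAt (fun y => (∫ u in Set.Iic 0, p u) + ∫ u in (0 : ℝ)..y, p u) (p s) s :=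
    (intervalIntegral.integral_hasStrictDerivAt_right (hp.intervalIntegrable _ _)
      (hp.stronglyMeasurableAtFilter _ _) hp.continuousAt).const_add _
  refine h1.congr_of_eventuallyEq (Filter.Eventually.of_forall fun y => ?_)
  have := intervalIntegral.integral_Iic_sub_Iic (a := 0) (b := y) hi.integrableOn hi.integrableOn
  simp only
  linarith

theorem integral_Iic_mem_Ioo {p : ℝ → ℝ} (hi : Integrable p)
    (hpos : ∀ s, 0 < p s) (s : ℝ) : (∫ u in Set.Iic s, p u) ∈ Set.Ioo 0 (∫ u, p u) := by
  have key : ∀ t : Set ℝ, MeasurableSet t → volume t ≠ 0 → 0 < ∫ u in t, p u := by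
    intro t ht h0
    rw [setIntegral_pos_iff_support_of_nonneg_ae (Filter.Eventually.of_forall fun u => (hpos u).le)
      hi.integrableOn]
    have : Function.support p = Set.univ := by
      ext u
      simp [(hpos u).ne']
    rw [this, Set.univ_inter]
    exact pos_iff_ne_zero.2 h0
  refine ⟨key _ measurableSet_Iic (by simp), ?_⟩
  rw [← integral_add_compl (measurableSet_Iic (a := s)) hi]
  have := key (Set.Iic s)ᶜ measurableSet_Iic.compl (by simp)
  linarith

theorem strictMono_integral_Iic {p : ℝ → ℝ} (hp : Continuous p) (hi : Integrable p)
    (hpos : ∀ s, 0 < p s) : StrictMono fun s => ∫ u in Set.Iic s, p u :=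
  strictMono_of_hasDerivAt_pos
    (fun s => (hasStrictDerivAt_integral_Iic hp hi s).hasDerivAt) hpos

theorem exists_integral_Iic_eq {p : ℝ → ℝ} (hp : Continuous p) (hi : Integrable p)
    {c : ℝ} (hc : c ∈ Set.Ioo 0 (∫ u, p u)) : ∃ s, ∫ u in Set.Iic s, p u = c := by
  have hcont : Continuous fun s => ∫ u in Set.Iic s, p u :=
    continuous_iff_continuousAt.2 fun s => (hasStrictDerivAt_integral_Iic hp hi s).hasDerivAt.continuousAt
  have htop : Filter.Tendsto (fun s => ∫ u in Set.Iic s, p u) Filter.atTop (nhds (∫ u, p u)) := by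
    have := tendsto_setIntegral_of_monotone (μ := volume) (f := p) (s := fun s : ℝ => Set.Iic s)
      (fun _ => measurableSet_Iic) (fun a b h => Set.Iic_subset_Iic.2 h) hi.integrableOn
    simpa [Set.iUnion_Iic] using this
  have hbot : Filter.Tendsto (fun s => ∫ u in Set.Iic s, p u) Filter.atBot (nhds 0) := by
    have h2 := intervalIntegral_tendsto_integral_Iic (μ := volume) (0 : ℝ) hi.integrableOn
      Filter.tendsto_id
    have h3 := (tendsto_const_nhds (x := ∫ u in Set.Iic (0 : ℝ), p u)).sub h2
    rw [sub_self] at h3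
    refine h3.congr fun s => ?_
    rw [← intervalIntegral.integral_Iic_sub_Iic hi.integrableOn hi.integrableOn]
    simp
  obtain ⟨a, ha⟩ := (hbot.eventually (gt_mem_nhds hc.1)).exists
  obtain ⟨b, hb⟩ := (htop.eventually (lt_mem_nhds hc.2)).exists
  exact mem_range_of_exists_le_of_exists_ge hcont ⟨a, ha.le⟩ ⟨b, hb.le⟩

/-- The monotone rearrangement between two positive densities on the line. -/
theorem hasDerivAt_monotone_transport {p q : ℝ → ℝ} (hp : Continuous p) (hpi : Integrable p)
    (hp0 : ∀ s, 0 < p s) (hq : Continuous q) (hqi : Integrable q) (hq0 : ∀ s, 0 < q s)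
    {τ : ℝ → ℝ} (hτ : ∀ s, ∫ u in Set.Iic (τ s), q u =
      (∫ u, q u) * ((∫ u in Set.Iic s, p u) / ∫ u, p u)) :
    StrictMono τ ∧
      ∀ s, HasDerivAt τ ((∫ u, q u) * (p s / ∫ u, p u) / q (τ s)) s := by
  have hP : 0 < ∫ u, p u :=
    (integral_Iic_mem_Ioo hpi hp0 0).1.trans (integral_Iic_mem_Ioo hpi hp0 0).2
  have hQ : 0 < ∫ u, q u :=
    (integral_Iic_mem_Ioo hqi hq0 0).1.trans (integral_Iic_mem_Ioo hqi hq0 0).2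
  have hF := strictMono_integral_Iic hp hpi hp0
  have hG := strictMono_integral_Iic hq hqi hq0
  have hmono : StrictMono τ := by
    intro a b hab
    refine hG.lt_iff_lt.1 ?_
    simp only [hτ]
    have := hF hab
    gcongr
  have hsurj : Function.Surjective τ := by
    intro y
    obtain ⟨h1, h2⟩ := integral_Iic_mem_Ioo hqi hq0 y
    obtain ⟨s, hs⟩ := exists_integral_Iic_eq hp hpi
      (c := (∫ u, p u) * ((∫ u in Set.Iic y, q u) / ∫ u, q u))
      ⟨by positivity, by
        have : (∫ u in Set.Iic y, q u) / (∫ u, q u) < 1 := (div_lt_one hQ).2 h2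
        nlinarith⟩
    refine ⟨s, hG.injective ?_⟩
    simp only [hτ, hs]
    field_simp
  -- A monotone surjection of the line has no jumps. Continuity keeps τ near τ s, where the local
  -- inverse of the primitive of q recovers it.
  have hcont : Continuous τ := hmono.monotone.continuous_of_surjective hsurj
  refine ⟨hmono, fun s => ?_⟩
  have hd := hasStrictDerivAt_integral_Iic hq hqi (τ s)
  have hinv := (hd.to_localInverse (hq0 _).ne').hasDerivAt
  have hleft := hd.eventually_left_inverse (hq0 _).ne'
  rw [hτ] at hinv
  have hFd : HasDerivAt (fun y => (∫ u, q u) * ((∫ u in Set.Iic y, p u) / ∫ u, p u))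
      ((∫ u, q u) * (p s / ∫ u, p u)) s :=
    ((hasStrictDerivAt_integral_Iic hp hpi s).hasDerivAt.div_const _).const_mul _
  have hc := hinv.comp s hFd
  rw [div_eq_inv_mul]
  refine hc.congr_of_eventuallyEq ?_
  filter_upwards [hcont.continuousAt.eventually hleft] with y hy
  rw [Function.comp_apply, ← hτ, hy]

/-- Change of variables on the image of S. Only an upper bound is needed later, so surjectivity of S
and measurability of G can be dispensed with. -/
theorem lintegral_comp_mul_deriv_le {S b : ℝ → ℝ} (hS : Function.Injective S)
    (hb : ∀ s, HasDerivAt S (b s) s) (G : ℝ → ℝ≥0∞) :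
    ∫⁻ s, G (S s) * ENNReal.ofReal (b s) ≤ ∫⁻ y, G y := by
  have h := lintegral_image_eq_lintegral_abs_deriv_mul MeasurableSet.univ
    (fun x _ => (hb x).hasDerivWithinAt) hS.injOn G
  rw [setLIntegral_univ] at h
  calc _ ≤ ∫⁻ s, ENNReal.ofReal |b s| * G (S s) := by
        refine lintegral_mono fun s => ?_
        rw [mul_comm]
        gcongr
        exact le_abs_self _
    _ = _ := h.symm
    _ ≤ _ := setLIntegral_le_lintegral _ _

end OneDimensional

/-! ### Dominated densities and the Knothe-Rosenblatt map -/

section Marginal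

/-- Continuous positive densities dominated by a product of integrable functions. -/
structure IsDominatedDensity {N : ℕ} (ρ : (Fin N → ℝ) → ℝ) : Prop where
  continuous : Continuous ρ
  pos : ∀ x, 0 < ρ x
  bound : ∃ C, ∀ x, ρ x ≤ C * ∏ i, (1 + x i ^ 2)⁻¹

/-- The marginal density obtained by integrating the first coordinate. -/
noncomputable def marginal {N : ℕ} (ρ : (Fin (N + 1) → ℝ) → ℝ) (x : Fin N → ℝ) : ℝ :=
  ∫ s, ρ (Fin.cons s x)

theorem measurePreserving_cons (N : ℕ) :
    MeasurePreserving (fun p : (Fin N → ℝ) × ℝ => (Fin.cons p.2 p.1 : Fin (N + 1) → ℝ)) := by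
  have h1 := (volume_preserving_piFinSuccAbove (fun _ : Fin (N + 1) => ℝ) 0).symm
  have h2 : MeasurePreserving (Prod.swap : (Fin N → ℝ) × ℝ → ℝ × (Fin N → ℝ)) :=
    Measure.measurePreserving_swap
  have h3 := h1.comp h2
  have : (⇑(MeasurableEquiv.piFinSuccAbove (fun _ : Fin (N + 1) => ℝ) 0).symm ∘ Prod.swap) =
      fun p : (Fin N → ℝ) × ℝ => (Fin.cons p.2 p.1 : Fin (N + 1) → ℝ) := by
    funext p
    simp [MeasurableEquiv.piFinSuccAbove, Fin.consEquiv]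
  rwa [this] at h3

theorem lintegral_cons {N : ℕ} {G : (Fin (N + 1) → ℝ) → ℝ≥0∞} (hG : Measurable G) :
    ∫⁻ x, G x = ∫⁻ x' : Fin N → ℝ, ∫⁻ s, G (Fin.cons s x') := by
  rw [← (measurePreserving_cons N).lintegral_comp hG, Measure.volume_eq_prod]
  exact lintegral_prod (fun p : (Fin N → ℝ) × ℝ => G (Fin.cons p.2 p.1))
    (hG.comp (measurePreserving_cons N).measurable).aemeasurable

theorem integrable_prod_inv_one_add_sq (N : ℕ) :
    Integrable fun x : Fin N → ℝ => ∏ i, (1 + x i ^ 2)⁻¹ :=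
  Integrable.fin_nat_prod (f := fun _ (s : ℝ) => (1 + s ^ 2)⁻¹) fun _ => integrable_inv_one_add_sq

theorem inv_one_add_sq_le_one (s : ℝ) : (1 + s ^ 2)⁻¹ ≤ 1 :=
  inv_le_one_of_one_le₀ (by nlinarith [sq_nonneg s])

namespace IsDominatedDensity

variable {N : ℕ}

theorem integrable {ρ : (Fin N → ℝ) → ℝ} (h : IsDominatedDensity ρ) : Integrable ρ := by
  obtain ⟨C, hC⟩ := h.bound
  refine ((integrable_prod_inv_one_add_sq N).const_mul C).mono'
    h.continuous.aestronglyMeasurable (Filter.Eventually.of_forall fun x => ?_)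
  rw [Real.norm_of_nonneg (h.pos x).le]
  exact hC x

theorem exists_bound_cons {ρ : (Fin (N + 1) → ℝ) → ℝ} (h : IsDominatedDensity ρ) :
    ∃ C, 0 ≤ C ∧ ∀ s x, ρ (Fin.cons s x) ≤ C * (1 + s ^ 2)⁻¹ * ∏ i, (1 + x i ^ 2)⁻¹ := by
  obtain ⟨C, hC⟩ := h.bound
  have hC' : ∀ s x, ρ (Fin.cons s x) ≤ C * (1 + s ^ 2)⁻¹ * ∏ i, (1 + x i ^ 2)⁻¹ := by
    intro s x
    have := hC (Fin.cons s x)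
    rw [Fin.prod_univ_succ] at this
    simpa [mul_assoc] using this
  refine ⟨C, ?_, hC'⟩
  have := (h.pos (Fin.cons 0 0)).le.trans (hC' 0 0)
  simpa using this

theorem continuous_slice {ρ : (Fin (N + 1) → ℝ) → ℝ} (h : IsDominatedDensity ρ) (x : Fin N → ℝ) :
    Continuous fun s => ρ (Fin.cons s x) :=
  h.continuous.comp (Continuous.finCons continuous_id continuous_const)

theorem integrable_slice {ρ : (Fin (N + 1) → ℝ) → ℝ} (h : IsDominatedDensity ρ) (x : Fin N → ℝ) :
    Integrable fun s => ρ (Fin.cons s x) := by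
  obtain ⟨C, -, hC⟩ := h.exists_bound_cons
  refine ((integrable_inv_one_add_sq.const_mul C).mul_const (∏ i, (1 + x i ^ 2)⁻¹)).mono'
    (h.continuous_slice x).aestronglyMeasurable (Filter.Eventually.of_forall fun s => ?_)
  rw [Real.norm_of_nonneg (h.pos _).le]
  exact hC s x

/-- The product form of the bound makes the class stable under integrating out a coordinate: the
other factors are at most 1, so one integrable function of s dominates all slices and the marginal
is continuous. -/
theorem marginal {ρ : (Fin (N + 1) → ℝ) → ℝ} (h : IsDominatedDensity ρ) :
    IsDominatedDensity (marginal ρ) := by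
  obtain ⟨C, hC0, hC⟩ := h.exists_bound_cons
  refine ⟨?_, fun x => ?_, C * ∫ s : ℝ, (1 + s ^ 2)⁻¹, fun x => ?_⟩
  · refine continuous_of_dominated (bound := fun s => C * (1 + s ^ 2)⁻¹)
      (fun x => (h.continuous_slice x).aestronglyMeasurable)
      (fun x => Filter.Eventually.of_forall fun s => ?_) (integrable_inv_one_add_sq.const_mul C)
      (Filter.Eventually.of_forall fun s =>
        h.continuous.comp (Continuous.finCons continuous_const continuous_id))
    rw [Real.norm_of_nonneg (h.pos _).le]
    refine (hC s x).trans (mul_le_of_le_one_right (by positivity) ?_)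
    exact Finset.prod_le_one (fun i _ => by positivity) fun i _ => inv_one_add_sq_le_one _
  · have := integral_Iic_mem_Ioo (h.integrable_slice x) (fun s => h.pos _) 0
    exact this.1.trans this.2
  · rw [← integral_const_mul, ← integral_mul_const]
    exact integral_mono (h.integrable_slice x)
      ((integrable_inv_one_add_sq.const_mul C).mul_const _) fun s => hC s x

theorem integral_marginal {ρ : (Fin (N + 1) → ℝ) → ℝ} (h : IsDominatedDensity ρ) :
    ∫ x, GibbsSampler.marginal ρ x = ∫ x, ρ x := by
  have hc : Measurable fun p : (Fin N → ℝ) × ℝ => (Fin.cons p.2 p.1 : Fin (N + 1) → ℝ) :=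
    (measurePreserving_cons N).measurable
  have h1 : ∫ x, ρ x = ∫ p : (Fin N → ℝ) × ℝ, ρ (Fin.cons p.2 p.1) := by
    rw [← (measurePreserving_cons N).map_eq, integral_map hc.aemeasurable
      h.continuous.aestronglyMeasurable]
  rw [h1, Measure.volume_eq_prod, integral_prod]
  · rfl
  · rw [← Measure.volume_eq_prod]
    exact (measurePreserving_cons N).integrable_comp_of_integrable h.integrable

theorem measurable_integral_Iic {ρ : (Fin (N + 1) → ℝ) → ℝ} (h : IsDominatedDensity ρ) :
    Measurable fun p : (Fin N → ℝ) × ℝ => ∫ u in Set.Iic p.2, ρ (Fin.cons u p.1) := by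
  have : (fun p : (Fin N → ℝ) × ℝ => ∫ u in Set.Iic p.2, ρ (Fin.cons u p.1)) =
      fun p => ∫ u, {q : ((Fin N → ℝ) × ℝ) × ℝ | q.2 ≤ q.1.2}.indicator
        (fun q => ρ (Fin.cons q.2 q.1.1)) (p, u) := by
    funext p
    rw [← integral_indicator measurableSet_Iic]
    rfl
  rw [this]
  refine (StronglyMeasurable.integral_prod_right (ν := volume)
    (f := fun p u => {q : ((Fin N → ℝ) × ℝ) × ℝ | q.2 ≤ q.1.2}.indicator
        (fun q => ρ (Fin.cons q.2 q.1.1)) (p, u)) ?_).measurable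
  refine Measurable.stronglyMeasurable (Measurable.indicator ?_
    (measurableSet_le measurable_snd measurable_fst.snd))
  exact (h.continuous.comp (Continuous.finCons continuous_snd continuous_fst.fst)).measurable

end IsDominatedDensity

/-- The inductive step of the rearrangement: the conditional law of the first coordinate under ρ
given x is sent to the conditional law under σ given T x, by matching distribution functions. -/
theorem exists_conditional_transport {N : ℕ} {ρ σ : (Fin (N + 1) → ℝ) → ℝ}
    (hρ : IsDominatedDensity ρ) (hσ : IsDominatedDensity σ) {T : (Fin N → ℝ) → Fin N → ℝ}
    (hT : Measurable T) :
    ∃ τ : (Fin N → ℝ) × ℝ → ℝ, Measurable τ ∧ ∀ x, (StrictMono fun s => τ (x, s)) ∧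
      ∀ s, HasDerivAt (fun s => τ (x, s)) (marginal σ (T x) * (ρ (Fin.cons s x) / marginal ρ x) /
        σ (Fin.cons (τ (x, s)) (T x))) s := by
  have hex : ∀ p : (Fin N → ℝ) × ℝ, ∃ y, ∫ u in Set.Iic y, σ (Fin.cons u (T p.1)) =
      marginal σ (T p.1) * ((∫ u in Set.Iic p.2, ρ (Fin.cons u p.1)) / marginal ρ p.1) := by
    intro p
    have h1 := integral_Iic_mem_Ioo (hρ.integrable_slice p.1) (fun s => hρ.pos _) p.2
    have h2 := hσ.marginal.pos (T p.1)
    have h3 := hρ.marginal.pos p.1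
    refine exists_integral_Iic_eq (hσ.continuous_slice _) (hσ.integrable_slice _)
      ⟨mul_pos h2 (div_pos h1.1 h3), ?_⟩
    exact mul_lt_of_lt_one_right h2 ((div_lt_one h3).2 h1.2)
  choose τ hτ using hex
  refine ⟨τ, ?_, fun x => ?_⟩
  · refine measurable_of_Iio fun y => ?_
    -- The choice of τ carries no measurability by itself, but strict monotonicity of the
    -- distribution function turns τ p < y into an inequality between measurable functions of p.
    have : τ ⁻¹' Set.Iio y = {p | marginal σ (T p.1) *
        ((∫ u in Set.Iic p.2, ρ (Fin.cons u p.1)) / marginal ρ p.1) <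
          ∫ u in Set.Iic y, σ (Fin.cons u (T p.1))} := by
      ext p
      rw [Set.mem_preimage, Set.mem_Iio, Set.mem_ofPred_eq, ← hτ]
      exact (strictMono_integral_Iic (hσ.continuous_slice _) (hσ.integrable_slice _)
        fun s => hσ.pos _).lt_iff_lt.symm
    rw [this]
    refine measurableSet_lt ?_ ?_
    · exact (hσ.marginal.continuous.measurable.comp (hT.comp measurable_fst)).mul
        (hρ.measurable_integral_Iic.div (hρ.marginal.continuous.measurable.comp measurable_fst))
    · exact hσ.measurable_integral_Iic.comp ((hT.comp measurable_fst).prodMk measurable_const)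
  · exact hasDerivAt_monotone_transport (hρ.continuous_slice x) (hρ.integrable_slice x)
      (fun s => hρ.pos _) (hσ.continuous_slice _) (hσ.integrable_slice _) (fun s => hσ.pos _)
      fun s => hτ (x, s)

/-- The Knothe-Rosenblatt rearrangement, with the diagonal `a` of its Jacobian. Partial displacement
of some of the coordinates satisfies the area inequality. -/
theorem exists_triangular_transport (N : ℕ) : ∀ {ρ σ : (Fin N → ℝ) → ℝ},
    IsDominatedDensity ρ → IsDominatedDensity σ → ∫ x, ρ x = ∫ x, σ x →
    ∃ T a : (Fin N → ℝ) → Fin N → ℝ, Measurable T ∧ Measurable a ∧ (∀ x k, 0 < a x k) ∧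
      (∀ x, (∏ k, a x k) * σ (T x) = ρ x) ∧
      ∀ t : Fin N → ℝ, (∀ k, t k ∈ Set.Icc 0 1) → ∀ G : (Fin N → ℝ) → ℝ≥0∞, Measurable G →
        ∫⁻ x, G (fun k => (1 - t k) * x k + t k * T x k) *
          ENNReal.ofReal (∏ k, (1 - t k + t k * a x k)) ≤ ∫⁻ x, G x := by
  induction N with
  | zero =>
    intro ρ σ hρ hσ heq
    refine ⟨id, 1, measurable_id, measurable_const, fun x k => k.elim0, fun x => ?_,
      fun t ht G hG => ?_⟩
    -- In dimension zero the integral is evaluation at the only point, so equality of masses is the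
    -- Jacobian equation.
    · have h1 : ∀ r : (Fin 0 → ℝ) → ℝ, ∫ x, r x = r x := fun r => by
        rw [integral_unique]
        simp [Measure.real, volume_pi]
        exact congrArg r (Subsingleton.elim _ _)
      simpa [h1] using heq.symm
    · simp only [Finset.univ_eq_empty, Finset.prod_empty, ENNReal.ofReal_one, mul_one]
      exact le_of_eq (lintegral_congr fun x => congrArg G (Subsingleton.elim _ _))
  | succ N ih =>
    intro ρ σ hρ hσ heq
    obtain ⟨T, a, hT, ha, ha0, hprod, harea⟩ := ih hρ.marginal hσ.marginal
      (by rw [hρ.integral_marginal, hσ.integral_marginal, heq])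
    obtain ⟨τ, hτ, hτ'⟩ := exists_conditional_transport hρ hσ hT
    set b : (Fin N → ℝ) × ℝ → ℝ := fun p => marginal σ (T p.1) *
      (ρ (Fin.cons p.2 p.1) / marginal ρ p.1) / σ (Fin.cons (τ p) (T p.1)) with hbdef
    have hcons : Measurable fun p : (Fin N → ℝ) × ℝ => (Fin.cons p.2 p.1 : Fin (N + 1) → ℝ) :=
      (measurePreserving_cons N).measurable
    have hb : Measurable b := by
      refine Measurable.div (Measurable.mul ?_ (Measurable.div ?_ ?_)) ?_
      · exact hσ.marginal.continuous.measurable.comp (hT.comp measurable_fst)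
      · exact hρ.continuous.measurable.comp hcons
      · exact hρ.marginal.continuous.measurable.comp measurable_fst
      · exact hσ.continuous.measurable.comp (hcons.comp ((hT.comp measurable_fst).prodMk hτ))
    have hb0 : ∀ p, 0 < b p := fun p => div_pos (mul_pos (hσ.marginal.pos _)
      (div_pos (hρ.pos _) (hρ.marginal.pos _))) (hσ.pos _)
    have hsplit : Measurable fun x : Fin (N + 1) → ℝ => ((Fin.tail x, x 0) : (Fin N → ℝ) × ℝ) :=
      (measurable_pi_lambda _ fun i => measurable_pi_apply _).prodMk (measurable_pi_apply _)
    refine ⟨fun x => Fin.cons (τ (Fin.tail x, x 0)) (T (Fin.tail x)),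
      fun x => Fin.cons (b (Fin.tail x, x 0)) (a (Fin.tail x)), ?_, ?_, fun x k => ?_,
      fun x => ?_, fun t ht G hG => ?_⟩
    · exact hcons.comp ((hT.comp hsplit.fst).prodMk (hτ.comp hsplit))
    · exact hcons.comp ((ha.comp hsplit.fst).prodMk (hb.comp hsplit))
    · refine Fin.cases ?_ (fun j => ?_) k
      · simpa using hb0 _
      · simpa using ha0 _ j
    · rw [Fin.prod_univ_succ]
      simp only [Fin.cons_zero, Fin.cons_succ, hbdef]
      have h1 := hprod (Fin.tail x)
      have h2 := (hσ.pos (Fin.cons (τ (Fin.tail x, x 0)) (T (Fin.tail x)))).ne'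
      have h3 := (hρ.marginal.pos (Fin.tail x)).ne'
      rw [Fin.cons_self_tail]
      field_simp
      rw [← h1]
      ring
    · have hT' : Measurable fun x : Fin (N + 1) → ℝ =>
          (Fin.cons (τ (Fin.tail x, x 0)) (T (Fin.tail x)) : Fin (N + 1) → ℝ) :=
        hcons.comp ((hT.comp hsplit.fst).prodMk (hτ.comp hsplit))
      have ha' : Measurable fun x : Fin (N + 1) → ℝ =>
          (Fin.cons (b (Fin.tail x, x 0)) (a (Fin.tail x)) : Fin (N + 1) → ℝ) :=
        hcons.comp ((ha.comp hsplit.fst).prodMk (hb.comp hsplit))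
      have hmeas : Measurable fun x : Fin (N + 1) → ℝ =>
          G (fun k => (1 - t k) * x k + t k *
            (Fin.cons (τ (Fin.tail x, x 0)) (T (Fin.tail x)) : Fin (N + 1) → ℝ) k) *
          ENNReal.ofReal (∏ k, (1 - t k + t k *
            (Fin.cons (b (Fin.tail x, x 0)) (a (Fin.tail x)) : Fin (N + 1) → ℝ) k)) := by
        refine (hG.comp (measurable_pi_lambda _ fun k => ?_)).mul
          (Finset.measurable_prod _ fun k _ => ?_).ennreal_ofReal
        · exact ((measurable_pi_apply k).const_mul _).add
            (((measurable_pi_apply k).comp hT').const_mul _)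
        · exact (((measurable_pi_apply k).comp ha').const_mul _).const_add _
      have hJ : ∀ k r, 0 < r → 0 ≤ 1 - t k + t k * r := fun k r hr => by
        have := ht k
        have := mul_nonneg this.1 hr.le
        linarith [(ht k).2]
      -- Tonelli replaces a change of variables in several dimensions, so no regularity of T in the
      -- tail is needed: with the tail fixed, the first coordinate is changed on the line, and what
      -- remains is the induction hypothesis for H.
      set H : (Fin N → ℝ) → ℝ≥0∞ := fun y => ∫⁻ s, G (Fin.cons s y) with hH
      have hHm : Measurable H :=
        Measurable.lintegral_prod_right' (f := fun p : (Fin N → ℝ) × ℝ => G (Fin.cons p.2 p.1))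
          (hG.comp hcons)
      rw [lintegral_cons hmeas, lintegral_cons hG]
      refine le_trans (lintegral_mono fun x => ?_)
        (harea (fun k => t k.succ) (fun k => ht _) H hHm)
      set y : Fin N → ℝ := fun k => (1 - t k.succ) * x k + t k.succ * T x k with hy
      set J : ℝ := ∏ k : Fin N, (1 - t k.succ + t k.succ * a x k) with hJdef
      have hJ0 : 0 ≤ J := Finset.prod_nonneg fun k _ => hJ _ _ (ha0 _ _)
      have hstep := lintegral_comp_mul_deriv_le
        (S := fun s => (1 - t 0) * s + t 0 * τ (x, s))
        (b := fun s => 1 - t 0 + t 0 * b (x, s)) ?_ ?_ (fun s => G (Fin.cons s y))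
      · calc _ = ∫⁻ s, (G (Fin.cons ((1 - t 0) * s + t 0 * τ (x, s)) y) *
              ENNReal.ofReal (1 - t 0 + t 0 * b (x, s))) * ENNReal.ofReal J := by
              refine lintegral_congr fun s => ?_
              rw [Fin.prod_univ_succ, ENNReal.ofReal_mul (by simpa using hJ 0 _ (hb0 (x, s))),
                ← mul_assoc]
              congr 3
              funext k
              refine Fin.cases ?_ (fun j => ?_) k <;> simp [hy]
          _ = _ := lintegral_mul_const' _ _ ENNReal.ofReal_ne_top
          _ ≤ _ := by gcongr
      · have h01 := ht 0
        have hm := (hτ' x).1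
        refine StrictMono.injective fun s s' hs => ?_
        have := hm hs
        simp only at this ⊢
        -- For t 0 = 0 the displacement is the identity. Otherwise strictness comes from τ, which
        -- also covers t 0 = 1.
        rcases h01.1.eq_or_lt with h0 | h0
        · rw [← h0]; linarith
        · have h2 := mul_lt_mul_of_pos_left this h0
          have h3 := mul_le_mul_of_nonneg_left hs.le (sub_nonneg.2 h01.2)
          linarith
      · intro s
        have h1 := ((hasDerivAt_id s).const_mul (1 - t 0)).add (((hτ' x).2 s).const_mul (t 0))
        rw [mul_one] at h1
        exact h1

end Marginal

/-! ### Transport compatible with the blocks -/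

section BlockTransport

variable {M : ℕ} {d : Fin M → ℕ}

/-- All real coordinates of a state, in a single vector. -/
def flatten (x : State d) : Fin (∑ m, d m) → ℝ :=
  fun k => x (finSigmaFinEquiv.symm k).1 (finSigmaFinEquiv.symm k).2

/-- The inverse of `flatten`. -/
def unflatten (y : Fin (∑ m, d m) → ℝ) : State d :=
  fun m => WithLp.toLp 2 fun i => y (finSigmaFinEquiv ⟨m, i⟩)

@[simp] theorem unflatten_apply (y : Fin (∑ m, d m) → ℝ) (m : Fin M) (i : Fin (d m)) :
    unflatten y m i = y (finSigmaFinEquiv ⟨m, i⟩) := rfl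

@[simp] theorem flatten_finSigmaFinEquiv (x : State d) (m : Fin M) (i : Fin (d m)) :
    flatten x (finSigmaFinEquiv ⟨m, i⟩) = x m i := by
  unfold flatten
  rw [Equiv.symm_apply_apply]

@[simp] theorem unflatten_flatten (x : State d) : unflatten (flatten x) = x := by
  funext m
  ext i
  simp

@[simp] theorem flatten_unflatten (y : Fin (∑ m, d m) → ℝ) :
    flatten (unflatten (d := d) y) = y := by
  funext k
  obtain ⟨⟨m, i⟩, rfl⟩ := finSigmaFinEquiv.surjective k
  simp

theorem continuous_flatten : Continuous (flatten (d := d)) := by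
  unfold flatten
  fun_prop

theorem continuous_unflatten : Continuous (unflatten (d := d)) := by
  unfold unflatten
  fun_prop

theorem prod_finSigmaFinEquiv {α : Type*} [CommMonoid α] (f : Fin (∑ m, d m) → α) :
    ∏ k, f k = ∏ m, ∏ i : Fin (d m), f (finSigmaFinEquiv ⟨m, i⟩) := by
  rw [← Fintype.prod_sigma' (fun m (i : Fin (d m)) => f (finSigmaFinEquiv ⟨m, i⟩))]
  exact (finSigmaFinEquiv.prod_comp f).symm

theorem measurePreserving_flatten : MeasurePreserving (flatten (d := d)) := by
  refine ⟨continuous_flatten.measurable, ?_⟩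
  rw [volume_pi]
  refine (Measure.pi_eq fun s hs => ?_).symm
  rw [Measure.map_apply continuous_flatten.measurable (MeasurableSet.univ_pi hs)]
  have : flatten (d := d) ⁻¹' Set.univ.pi s = Set.univ.pi fun m => WithLp.ofLp ⁻¹'
      Set.univ.pi fun i : Fin (d m) => s (finSigmaFinEquiv ⟨m, i⟩) := by
    ext x
    simp only [Set.mem_preimage, Set.mem_univ_pi]
    refine ⟨fun h m i => by simpa using h (finSigmaFinEquiv ⟨m, i⟩), fun h k => ?_⟩
    obtain ⟨⟨m, i⟩, rfl⟩ := finSigmaFinEquiv.surjective k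
    simpa using h m i
  rw [this, Measure.pi_pi, prod_finSigmaFinEquiv]
  refine Finset.prod_congr rfl fun m _ => ?_
  rw [(PiLp.volume_preserving_ofLp (Fin (d m))).measure_preimage
    (MeasurableSet.univ_pi fun i => hs _).nullMeasurableSet, volume_pi, Measure.pi_pi]

theorem measurableEmbedding_flatten : MeasurableEmbedding (flatten (d := d)) :=
  (⟨⟨flatten, unflatten, unflatten_flatten, flatten_unflatten⟩, continuous_flatten.measurable,
    continuous_unflatten.measurable⟩ : State d ≃ᵐ (Fin (∑ m, d m) → ℝ)).measurableEmbedding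

theorem map_unflatten : Measure.map (unflatten (d := d)) volume = volume := by
  rw [← measurePreserving_flatten.map_eq, Measure.map_map continuous_unflatten.measurable
    continuous_flatten.measurable]
  convert Measure.map_id
  funext x
  simp

theorem measurePreserving_unflatten : MeasurePreserving (unflatten (d := d)) :=
  ⟨continuous_unflatten.measurable, map_unflatten⟩

/-- Continuous positive densities on the state space, dominated by a product of integrable functions
of the coordinates. -/
structure IsDominatedStateDensity (ρ : State d → ℝ) : Prop where
  continuous : Continuous ρ
  pos : ∀ x, 0 < ρ x
  bound : ∃ C, ∀ x, ρ x ≤ C * ∏ m, ∏ i, (1 + x m i ^ 2)⁻¹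

theorem IsDominatedStateDensity.comp_unflatten {ρ : State d → ℝ} (h : IsDominatedStateDensity ρ) :
    IsDominatedDensity fun y => ρ (unflatten y) := by
  obtain ⟨C, hC⟩ := h.bound
  refine ⟨h.continuous.comp continuous_unflatten, fun y => h.pos _, C, fun y => ?_⟩
  rw [prod_finSigmaFinEquiv]
  exact hC _

theorem IsDominatedStateDensity.integrable {ρ : State d → ℝ} (h : IsDominatedStateDensity ρ) :
    Integrable ρ := by
  have := measurePreserving_flatten.integrable_comp_of_integrable h.comp_unflatten.integrable
  simpa [Function.comp_def] using this

/-- Weighted arithmetic-geometric inequality. Multiplied over a block, it plays the role of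
log-concavity of the determinant. -/
theorem rpow_le_affine {a t : ℝ} (ha : 0 < a) (ht : t ∈ Set.Icc (0 : ℝ) 1) :
    a ^ t ≤ 1 - t + t * a := by
  have := Real.geom_mean_le_arith_mean2_weighted (sub_nonneg.2 ht.2) ht.1 zero_le_one ha.le
    (sub_add_cancel 1 t)
  simpa using this

/-- A transport of one density to another which is compatible with the displacement of one block:
`D x m` plays the role of the Jacobian determinant of the `m`-th block. -/
theorem exists_block_transport {ρ σ : State d → ℝ} (hρ : IsDominatedStateDensity ρ)
    (hσ : IsDominatedStateDensity σ) (heq : ∫ x, ρ x = ∫ x, σ x) :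
    ∃ (T : State d → State d) (D : State d → Fin M → ℝ), Measurable T ∧ Measurable D ∧
      (∀ x m, 0 < D x m) ∧ (∀ x, (∏ m, D x m) * σ (T x) = ρ x) ∧
      ∀ t ∈ Set.Icc (0 : ℝ) 1, ∀ m, ∀ G : State d → ℝ≥0∞, Measurable G →
        ∫⁻ x, G (Function.update x m ((1 - t) • x m + t • T x m)) * ENNReal.ofReal (D x m ^ t) ≤
          ∫⁻ x, G x := by
  have hint : ∀ r : State d → ℝ, Continuous r → ∫ y, r (unflatten y) = ∫ x, r x := by
    intro r hr
    rw [← map_unflatten (d := d), integral_map continuous_unflatten.aemeasurable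
      hr.aestronglyMeasurable]
  obtain ⟨T, a, hT, ha, ha0, hprod, harea⟩ := exists_triangular_transport _
    hρ.comp_unflatten hσ.comp_unflatten
    (by rw [hint ρ hρ.continuous, hint σ hσ.continuous, heq])
  refine ⟨fun x => unflatten (T (flatten x)),
    fun x m => ∏ i : Fin (d m), a (flatten x) (finSigmaFinEquiv ⟨m, i⟩), ?_, ?_, ?_, ?_, ?_⟩
  · exact continuous_unflatten.measurable.comp (hT.comp continuous_flatten.measurable)
  · refine measurable_pi_lambda _ fun m => Finset.measurable_prod _ fun i _ => ?_
    exact (measurable_pi_apply _).comp (ha.comp continuous_flatten.measurable)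
  · exact fun x m => Finset.prod_pos fun i _ => ha0 _ _
  · intro x
    have := hprod (flatten x)
    rwa [prod_finSigmaFinEquiv, unflatten_flatten] at this
  · intro t ht m G hG
    -- Displacement parameters may differ between coordinates. Those outside block m are frozen and
    -- contribute factors 1 to the Jacobian.
    set θ : Fin (∑ m, d m) → ℝ := fun k => if (finSigmaFinEquiv.symm k).1 = m then t else 0 with hθ
    have hθm : ∀ m' (i : Fin (d m')), θ (finSigmaFinEquiv ⟨m', i⟩) = if m' = m then t else 0 :=
      fun m' i => by simp [hθ]
    have h1 := harea θ (fun k => by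
      simp only [hθ]
      split_ifs
      · exact ht
      · simp) (fun y => G (unflatten y)) (hG.comp continuous_unflatten.measurable)
    rw [measurePreserving_unflatten.lintegral_comp hG,
      ← measurePreserving_flatten.lintegral_comp_emb measurableEmbedding_flatten] at h1
    refine le_trans (lintegral_mono fun x => ?_) h1
    have hS : unflatten (fun k => (1 - θ k) * flatten x k + θ k * T (flatten x) k) =
        Function.update x m ((1 - t) • x m + t • unflatten (T (flatten x)) m) := by
      funext m'
      ext i
      rw [unflatten_apply, hθm, flatten_finSigmaFinEquiv]
      rcases eq_or_ne m' m with rfl | hne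
      · simp
      · simp [hne]
    rw [hS]
    gcongr
    rw [prod_finSigmaFinEquiv, ← Real.finsetProd_rpow _ _ fun i _ => (ha0 _ _).le]
    rw [Finset.prod_eq_single m]
    · refine Finset.prod_le_prod (fun i _ => Real.rpow_nonneg (ha0 _ _).le _) fun i _ => ?_
      rw [hθm, if_pos rfl]
      exact rpow_le_affine (ha0 _ _) ht
    · intro m' _ hne
      refine Finset.prod_eq_one fun i _ => ?_
      rw [hθm, if_neg hne]
      ring
    · simp

end BlockTransport

/-! ### Growth and convexity of the potential -/

section Potential

variable {M : ℕ} {d : Fin M → ℕ}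

theorem hasFDerivAt_comp_update {f : State d → ℝ} (hf : Differentiable ℝ f) (x : State d)
    (m : Fin M) (y : EuclideanSpace ℝ (Fin (d m))) :
    HasFDerivAt (fun y => f (Function.update x m y))
      ((fderiv ℝ f (Function.update x m y)).comp
        (ContinuousLinearMap.single ℝ (fun m => EuclideanSpace ℝ (Fin (d m))) m)) y := by
  have h : HasFDerivAt (Function.update x m)
      (ContinuousLinearMap.single ℝ (fun m => EuclideanSpace ℝ (Fin (d m))) m) y := by
    refine (hasFDerivAt_update x y).congr_fderiv ?_
    ext v j i
    rcases eq_or_ne j m with rfl | hne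
    · simp
    · simp [hne]
  exact (hf _).hasFDerivAt.comp y h

/-- The descent lemma for a function with Lipschitz gradient. -/
theorem le_add_fderiv_add_of_lipschitzWith_gradient {E : Type*} [NormedAddCommGroup E]
    [InnerProductSpace ℝ E] [CompleteSpace E] {g : E → ℝ} (hg : Differentiable ℝ g) {K : ℝ≥0}
    (hK : LipschitzWith K (gradient g)) (y v : E) :
    g (y + v) ≤ g y + fderiv ℝ g y v + K / 2 * ‖v‖ ^ 2 := by
  have hline : ∀ s : ℝ, HasDerivAt (fun s : ℝ => g (y + s • v)) (fderiv ℝ g (y + s • v) v) s := by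
    intro s
    have h1 : HasDerivAt (fun s : ℝ => y + s • v) v s := by
      simpa using ((hasDerivAt_id s).smul_const v).const_add y
    exact (hg _).hasFDerivAt.comp_hasDerivAt s h1
  have hbound : ∀ s : ℝ, 0 ≤ s → fderiv ℝ g (y + s • v) v ≤ fderiv ℝ g y v + K * s * ‖v‖ ^ 2 := by
    intro s hs
    have h1 : ∀ z, fderiv ℝ g z v = inner ℝ (gradient g z) v := fun z => by
      rw [gradient, InnerProductSpace.toDual_symm_apply]
    rw [h1, h1, ← sub_le_iff_le_add', ← inner_sub_left]
    refine (real_inner_le_norm _ _).trans ?_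
    have h2 := hK.dist_le_mul (y + s • v) y
    rw [dist_eq_norm, dist_eq_norm, add_sub_cancel_left, norm_smul, Real.norm_of_nonneg hs] at h2
    calc _ ≤ (K * (s * ‖v‖)) * ‖v‖ := by gcongr
      _ = _ := by ring
  have hanti : AntitoneOn
      (fun s : ℝ => g (y + s • v) - (s * fderiv ℝ g y v + K / 2 * ‖v‖ ^ 2 * s ^ 2))
      (Set.Ici 0) := by
    have hd : ∀ s : ℝ, HasDerivAt
        (fun s : ℝ => g (y + s • v) - (s * fderiv ℝ g y v + K / 2 * ‖v‖ ^ 2 * s ^ 2))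
        (fderiv ℝ g (y + s • v) v - (fderiv ℝ g y v + K / 2 * ‖v‖ ^ 2 * (2 * s))) s := by
      intro s
      refine (hline s).sub (HasDerivAt.add ?_ ?_)
      · simpa using (hasDerivAt_id s).mul_const (fderiv ℝ g y v)
      · simpa using (hasDerivAt_pow 2 s).const_mul (K / 2 * ‖v‖ ^ 2)
    refine antitoneOn_of_deriv_nonpos (convex_Ici 0)
      (fun s _ => (hd s).continuousAt.continuousWithinAt)
      (fun s _ => (hd s).differentiableAt.differentiableWithinAt) fun s hs => ?_
    rw [interior_Ici] at hs
    rw [(hd s).deriv]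
    linarith [hbound s (le_of_lt hs)]
  have := hanti (Set.mem_Ici.2 le_rfl) (Set.mem_Ici.2 zero_le_one) zero_le_one
  simp only [one_smul, zero_smul, add_zero] at this
  linarith

theorem weightedNormSq_add_smul (L : Fin M → ℝ≥0) (x v : State d) (s : ℝ) :
    weightedNormSq L (x + s • v) = weightedNormSq L x + s * (2 * ∑ m, L m * inner ℝ (x m) (v m)) +
      s ^ 2 * weightedNormSq L v := by
  simp only [weightedNormSq, Finset.mul_sum, ← Finset.sum_add_distrib]
  refine Finset.sum_congr rfl fun m _ => ?_
  rw [Pi.add_apply, Pi.smul_apply, norm_add_sq_real, inner_smul_right, norm_smul, mul_pow,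
    Real.norm_eq_abs, sq_abs]
  ring

/-- A finite convex function on a finite-dimensional space has a minorant of linear growth. -/
theorem exists_neg_mul_le_of_convexOn {E : Type*} [NormedAddCommGroup E] [NormedSpace ℝ E]
    [FiniteDimensional ℝ E] {f : E → ℝ} (hf : ConvexOn ℝ Set.univ f) :
    ∃ A, ∀ y, -(A * (1 + ‖y‖)) ≤ f y := by
  have hcont : Continuous f := continuousOn_univ.1 (hf.continuousOn isOpen_univ)
  obtain ⟨C, hC⟩ := (isCompact_closedBall (0 : E) 1).exists_bound_of_continuousOn hcont.continuousOn
  have hC' : ∀ y : E, ‖y‖ ≤ 1 → |f y| ≤ C := fun y hy => hC y (by simpa using hy)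
  have hC0 : 0 ≤ C := (abs_nonneg _).trans (hC' 0 (by simp))
  refine ⟨2 * C, fun y => ?_⟩
  rcases le_or_gt ‖y‖ 1 with hy | hy
  · have := (abs_le.1 (hC' y hy)).1
    nlinarith [norm_nonneg y]
  · have hy0 : 0 < ‖y‖ := one_pos.trans hy
    have h1 : ‖‖y‖⁻¹ • y‖ = 1 := by
      rw [norm_smul, norm_inv, norm_norm, inv_mul_cancel₀ hy0.ne']
    have h2 := hf.2 (Set.mem_univ y) (Set.mem_univ 0) (inv_nonneg.2 hy0.le)
      (sub_nonneg.2 (inv_le_one_of_one_le₀ hy.le)) (add_sub_cancel _ _)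
    rw [smul_zero, add_zero, smul_eq_mul, smul_eq_mul] at h2
    have h3 := (abs_le.1 (hC' _ h1.le)).1
    have h4 := (abs_le.1 (hC' 0 (by simp))).2
    have h5 : -C ≤ ‖y‖⁻¹ * f y + (1 - ‖y‖⁻¹) * C :=
      h3.trans (h2.trans (by
        have : 0 ≤ 1 - ‖y‖⁻¹ := sub_nonneg.2 (inv_le_one_of_one_le₀ hy.le)
        gcongr))
    have h6 := mul_le_mul_of_nonneg_left h5 hy0.le
    have h7 : ‖y‖ * (‖y‖⁻¹ * f y + (1 - ‖y‖⁻¹) * C) = f y + (‖y‖ - 1) * C := by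
      field_simp
    rw [h7] at h6
    nlinarith

theorem exists_exp_quadratic_le_prod {n : ℕ} {a : ℝ} (ha : 0 < a) (A B : ℝ) :
    ∃ C, 0 ≤ C ∧ ∀ y : EuclideanSpace ℝ (Fin n),
      Real.exp (-(a * ‖y‖ ^ 2 - B * ‖y‖ - A)) ≤ C * ∏ i, (1 + y i ^ 2)⁻¹ := by
  -- The bound δ ≤ 1 gives 1 + s² ≤ δ⁻¹ exp(δ s²), and δ ≤ a / 2 leaves half of the quadratic term
  -- to absorb B‖y‖, at the cost B² / (2a).
  set δ := min 1 (a / 2) with hδ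
  have hδ0 : 0 < δ := lt_min one_pos (half_pos ha)
  refine ⟨(δ⁻¹) ^ n * Real.exp (B ^ 2 / (2 * a) + A), by positivity, fun y => ?_⟩
  have h1 : ∏ i, (1 + y i ^ 2) ≤ (δ⁻¹) ^ n * Real.exp (δ * ‖y‖ ^ 2) := by
    rw [EuclideanSpace.real_norm_sq_eq, Finset.mul_sum, Real.exp_sum]
    have : (δ⁻¹) ^ n = ∏ _i : Fin n, δ⁻¹ := by simp
    rw [this, ← Finset.prod_mul_distrib]
    refine Finset.prod_le_prod (fun i _ => by positivity) fun i _ => ?_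
    rw [inv_mul_eq_div, le_div_iff₀ hδ0]
    have h2 := Real.add_one_le_exp (δ * y i ^ 2)
    nlinarith [min_le_left 1 (a / 2)]
  rw [Finset.prod_inv_distrib, ← div_eq_mul_inv, le_div_iff₀ (Finset.prod_pos fun i _ => by positivity)]
  calc _ ≤ Real.exp (-(a * ‖y‖ ^ 2 - B * ‖y‖ - A)) * ((δ⁻¹) ^ n * Real.exp (δ * ‖y‖ ^ 2)) := by
        gcongr
    _ = (δ⁻¹) ^ n * Real.exp (-(a * ‖y‖ ^ 2 - B * ‖y‖ - A) + δ * ‖y‖ ^ 2) := by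
        rw [Real.exp_add]; ring
    _ ≤ _ := by
        refine mul_le_mul_of_nonneg_left (Real.exp_le_exp.2 ?_) (by positivity)
        have h3 : δ * ‖y‖ ^ 2 ≤ a / 2 * ‖y‖ ^ 2 := by
          gcongr
          exact min_le_right _ _
        have h4 : B * ‖y‖ - a / 2 * ‖y‖ ^ 2 ≤ B ^ 2 / (2 * a) := by
          rw [le_div_iff₀ (by positivity)]
          nlinarith [sq_nonneg (a * ‖y‖ - B)]
        linarith

namespace IsBlockConvexSmooth

variable {U U₀ : State d → ℝ} {V : (m : Fin M) → EuclideanSpace ℝ (Fin (d m)) → ℝ}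
  {L : Fin M → ℝ≥0} {lam : ℝ}

theorem differentiable (h : IsBlockConvexSmooth U U₀ V L lam) : Differentiable ℝ U₀ :=
  h.contDiff.differentiable one_ne_zero

theorem apply_update_le (h : IsBlockConvexSmooth U U₀ V L lam) (x : State d) (m : Fin M)
    (v : EuclideanSpace ℝ (Fin (d m))) :
    U₀ (Function.update x m (x m + v)) ≤
      U₀ x + fderiv ℝ U₀ x (Pi.single m v) + L m / 2 * ‖v‖ ^ 2 := by
  have h1 := le_add_fderiv_add_of_lipschitzWith_gradient
    (fun y => (hasFDerivAt_comp_update h.differentiable x m y).differentiableAt)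
    (h.smooth m x) (x m) v
  rw [(hasFDerivAt_comp_update h.differentiable x m (x m)).fderiv, Function.update_eq_self] at h1
  exact h1

/-- Along a line, the secant slope of a convex function over [0, 1] dominates its derivative at 0.
The cross terms of the weighted norm cancel. -/
theorem add_fderiv_add_le (h : IsBlockConvexSmooth U U₀ V L lam) (x v : State d) :
    U₀ x + fderiv ℝ U₀ x v + lam / 2 * weightedNormSq L v ≤ U₀ (x + v) := by
  set c : ℝ := 2 * ∑ m, L m * inner ℝ (x m) (v m) with hc
  have hconv : ConvexOn ℝ Set.univ
      fun s : ℝ => U₀ (x + s • v) - lam / 2 * weightedNormSq L (x + s • v) := by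
    have := h.strong_convex.comp_affineMap (AffineMap.lineMap x (x + v))
    simpa [AffineMap.lineMap_apply, Function.comp_def, add_comm] using this
  have hd : HasDerivAt (fun s : ℝ => U₀ (x + s • v) - lam / 2 * weightedNormSq L (x + s • v))
      (fderiv ℝ U₀ x v - lam / 2 * c) 0 := by
    simp only [weightedNormSq_add_smul, ← hc]
    refine HasDerivAt.sub ?_ (HasDerivAt.const_mul _ ?_)
    · have h1 : HasDerivAt (fun s : ℝ => x + s • v) v 0 := by
        simpa using ((hasDerivAt_id (0 : ℝ)).smul_const v).const_add x
      have h2 : HasFDerivAt U₀ (fderiv ℝ U₀ x) (x + (0 : ℝ) • v) := by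
        simpa using (h.differentiable x).hasFDerivAt
      exact h2.comp_hasDerivAt 0 h1
    · have h1 := (((hasDerivAt_id (0 : ℝ)).mul_const c).const_add (weightedNormSq L x)).add
        ((hasDerivAt_pow 2 (0 : ℝ)).mul_const (weightedNormSq L v))
      exact h1.congr_deriv (by simp)
  have := hconv.le_slope_of_hasDerivAt (Set.mem_univ 0) (Set.mem_univ 1) one_pos hd
  simp only [slope_def_field, weightedNormSq_add_smul, ← hc] at this
  simp only [one_smul, zero_smul, add_zero] at this
  linarith

theorem continuous (h : IsBlockConvexSmooth U U₀ V L lam) : Continuous U := by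
  have : U = fun x => U₀ x + ∑ m, V m (x m) := funext h.decomp
  rw [this]
  refine h.contDiff.continuous.add (continuous_finsetSum _ fun m _ => ?_)
  exact (continuousOn_univ.1 ((h.convex_block m).continuousOn isOpen_univ)).comp
    (continuous_apply m)

/-- Strong convexity makes U₀ grow quadratically, while each V m decreases at most linearly, so the
density has Gaussian tails. -/
theorem isDominatedStateDensity_exp (h : IsBlockConvexSmooth U U₀ V L lam) :
    IsDominatedStateDensity fun x => Real.exp (-U x) := by
  refine ⟨Real.continuous_exp.comp h.continuous.neg, fun x => Real.exp_pos _, ?_⟩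
  choose A hA using fun m => exists_neg_mul_le_of_convexOn (h.convex_block m)
  have hlam : ∀ m, 0 < lam / 2 * L m := fun m =>
    mul_pos (half_pos h.lam_pos) (NNReal.coe_pos.2 (h.const_pos m))
  choose C hC0 hC using fun m => exists_exp_quadratic_le_prod (n := d m) (hlam m) (A m)
    (A m + ‖(fderiv ℝ U₀ 0).comp (ContinuousLinearMap.single ℝ
      (fun m => EuclideanSpace ℝ (Fin (d m))) m)‖)
  refine ⟨Real.exp (-U₀ 0) * ∏ m, C m, fun x => ?_⟩
  rw [mul_assoc, ← Finset.prod_mul_distrib]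
  refine le_trans ?_ (mul_le_mul_of_nonneg_left
    (Finset.prod_le_prod (fun m _ => (Real.exp_pos _).le) fun m _ => hC m (x m))
    (Real.exp_pos _).le)
  rw [← Real.exp_sum, ← Real.exp_add, Real.exp_le_exp, h.decomp]
  have h1 := h.add_fderiv_add_le 0 x
  have h2 : fderiv ℝ U₀ 0 x = ∑ m, fderiv ℝ U₀ 0 (Pi.single m (x m)) := by
    conv_lhs => rw [← Finset.univ_sum_single x]
    rw [map_sum]
  rw [zero_add, h2, weightedNormSq, Finset.mul_sum, add_assoc, ← Finset.sum_add_distrib] at h1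
  have h3 : ∑ m, (lam / 2 * L m * ‖x m‖ ^ 2 - (A m + ‖(fderiv ℝ U₀ 0).comp
      (ContinuousLinearMap.single ℝ (fun m => EuclideanSpace ℝ (Fin (d m))) m)‖) * ‖x m‖ - A m) ≤
      ∑ m, (fderiv ℝ U₀ 0 (Pi.single m (x m)) + lam / 2 * (L m * ‖x m‖ ^ 2)) +
        ∑ m, V m (x m) := by
    rw [← Finset.sum_add_distrib]
    refine Finset.sum_le_sum fun m _ => ?_
    have h4 := ((fderiv ℝ U₀ 0).comp (ContinuousLinearMap.single ℝ
      (fun m => EuclideanSpace ℝ (Fin (d m))) m)).le_opNorm (x m)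
    have h5 := (abs_le.1 h4).1
    have h6 := hA m (x m)
    simp only [ContinuousLinearMap.comp_apply, ContinuousLinearMap.single_apply] at h5
    nlinarith
  rw [Finset.sum_neg_distrib]
  linarith

/-- The convexity constant exceeds `1` only on a trivial state space. -/
theorem lam_le_one_or_subsingleton (h : IsBlockConvexSmooth U U₀ V L lam) :
    lam ≤ 1 ∨ Subsingleton (State d) := by
  by_cases hs : ∃ m, ∃ v : EuclideanSpace ℝ (Fin (d m)), v ≠ 0
  · obtain ⟨m, v, hv⟩ := hs
    left
    -- For a displacement of a single block, the quadratic upper bound has constant L m and the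
    -- lower bound has lam * L m.
    have h1 := h.apply_update_le 0 m v
    have h2 := h.add_fderiv_add_le 0 (Pi.single m v)
    have h3 : weightedNormSq L (Pi.single m v : State d) = L m * ‖v‖ ^ 2 := by
      rw [weightedNormSq, Finset.sum_eq_single m]
      · rw [Pi.single_eq_same]
      · intro m' _ hne
        rw [Pi.single_eq_of_ne hne]
        simp
      · simp
    have h4 : Function.update (0 : State d) m ((0 : State d) m + v) = 0 + Pi.single m v := by
      rw [Pi.zero_apply, zero_add, zero_add]
      rfl
    rw [h4] at h1
    rw [h3] at h2
    have h5 : 0 < L m * ‖v‖ ^ 2 :=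
      mul_pos (NNReal.coe_pos.2 (h.const_pos m)) (pow_pos (norm_pos_iff.2 hv) 2)
    nlinarith
  · push Not at hs
    exact Or.inr ⟨fun x y => funext fun m => (hs m _).trans (hs m _).symm⟩

/-- Blockwise displacement of a point towards another one. -/
theorem sum_update_le (h : IsBlockConvexSmooth U U₀ V L lam) (hlam : lam ≤ 1) (x y : State d) :
    ∑ m, U (Function.update x m ((1 - lam) • x m + lam • y m)) ≤ M * U x + lam * (U y - U x) := by
  have hupd : ∀ m, (1 - lam) • x m + lam • y m = x m + lam • (y m - x m) := fun m => by module
  have h0 : ∑ m, U₀ (Function.update x m ((1 - lam) • x m + lam • y m)) ≤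
      M * U₀ x + lam * (U₀ y - U₀ x) := by
    have h1 := h.add_fderiv_add_le x (y - x)
    have h2 : fderiv ℝ U₀ x (y - x) = ∑ m, fderiv ℝ U₀ x (Pi.single m (y m - x m)) := by
      conv_lhs => rw [← Finset.univ_sum_single (y - x)]
      rw [map_sum]
      rfl
    -- This dictates the step length lam: smoothness costs lam² L m / 2 times the squared
    -- displacement, exactly lam times the gain lam L m / 2 from strong convexity.
    have h3 : ∀ m, U₀ (Function.update x m ((1 - lam) • x m + lam • y m)) ≤
        U₀ x + lam * (fderiv ℝ U₀ x (Pi.single m (y m - x m)) +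
          lam / 2 * (L m * ‖y m - x m‖ ^ 2)) := by
      intro m
      rw [hupd]
      refine (h.apply_update_le x m _).trans (le_of_eq ?_)
      rw [norm_smul, Pi.single_smul, map_smul, Real.norm_of_nonneg h.lam_pos.le, smul_eq_mul]
      ring
    refine (Finset.sum_le_sum fun m _ => h3 m).trans ?_
    rw [Finset.sum_add_distrib, ← Finset.mul_sum, Finset.sum_add_distrib, ← Finset.mul_sum, ← h2,
      Finset.sum_const, Finset.card_univ, Fintype.card_fin, nsmul_eq_mul]
    rw [add_sub_cancel] at h1
    have h4 : weightedNormSq L (y - x) = ∑ m, L m * ‖y m - x m‖ ^ 2 := rfl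
    rw [← h4]
    have := mul_le_mul_of_nonneg_left h1 h.lam_pos.le
    linarith
  have hV : ∑ m, ∑ j, V j (Function.update x m ((1 - lam) • x m + lam • y m) j) ≤
      M * ∑ j, V j (x j) + lam * (∑ j, V j (y j) - ∑ j, V j (x j)) := by
    have h1 : ∀ m, ∑ j, V j (Function.update x m ((1 - lam) • x m + lam • y m) j) ≤
        ∑ j, V j (x j) + lam * (V m (y m) - V m (x m)) := by
      intro m
      rw [← Finset.add_sum_erase _ _ (Finset.mem_univ m),
        ← Finset.add_sum_erase _ (fun j => V j (x j)) (Finset.mem_univ m),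
        Function.update_self]
      have h2 := (h.convex_block m).2 (Set.mem_univ (x m)) (Set.mem_univ (y m))
        (sub_nonneg.2 hlam) h.lam_pos.le (sub_add_cancel _ _)
      have h3 : ∑ j ∈ Finset.univ.erase m,
          V j (Function.update x m ((1 - lam) • x m + lam • y m) j) =
            ∑ j ∈ Finset.univ.erase m, V j (x j) :=
        Finset.sum_congr rfl fun j hj => by rw [Function.update_of_ne (Finset.ne_of_mem_erase hj)]
      rw [h3]
      simp only [smul_eq_mul] at h2
      linarith
    refine (Finset.sum_le_sum fun m _ => h1 m).trans (le_of_eq ?_)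
    rw [Finset.sum_add_distrib, ← Finset.mul_sum, Finset.sum_sub_distrib, Finset.sum_const,
      Finset.card_univ, Fintype.card_fin, nsmul_eq_mul]
  simp only [h.decomp, Finset.sum_add_distrib]
  linarith

end IsBlockConvexSmooth

end Potential

/-! ### The entropy inequality and its linearization -/

section Entropy

/-- Second-order expansion. The remainder of the logarithm is at most 2δ³ and is multiplied by |1 +
u| ≤ 2; the term u v² / 2 adds δ³ / 2. The constant 7 is generous. -/
theorem abs_mul_log_sub_le {u v δ : ℝ} (hu : |u| ≤ δ) (hv : |v| ≤ δ) (hδ : δ ≤ 1 / 2) :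
    |(1 + u) * Real.log (1 + v) - (v + (u * v - v ^ 2 / 2))| ≤ 7 * δ ^ 3 := by
  have hδ0 : 0 ≤ δ := (abs_nonneg u).trans hu
  have h1 := Real.abs_log_sub_add_sum_range_le (x := -v) (by rw [abs_neg]; linarith) 2
  rw [abs_neg, sub_neg_eq_add] at h1
  simp only [Finset.sum_range_succ, Finset.sum_range_zero] at h1
  have h2 : |v| ^ (2 + 1) / (1 - |v|) ≤ 2 * δ ^ 3 := by
    rw [div_le_iff₀ (by linarith)]
    have h3 : |v| ^ 3 ≤ δ ^ 3 := by gcongr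
    have h4 : 0 ≤ δ ^ 3 := by positivity
    norm_num
    nlinarith
  set r : ℝ := Real.log (1 + v) - v + v ^ 2 / 2 with hr
  have hr' : |r| ≤ 2 * δ ^ 3 := by
    refine le_trans (le_of_eq ?_) (h1.trans h2)
    rw [hr]
    congr 1
    norm_num
    ring
  have h5 : (1 + u) * Real.log (1 + v) - (v + (u * v - v ^ 2 / 2)) =
      (1 + u) * r - u * v ^ 2 / 2 := by
    rw [hr]; ring
  have h6 : |u * v ^ 2 / 2| ≤ δ ^ 3 / 2 := by
    rw [abs_div, abs_mul, abs_pow, abs_two]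
    have : |u| * |v| ^ 2 ≤ δ * δ ^ 2 := by gcongr
    have h7 : δ * δ ^ 2 = δ ^ 3 := by ring
    linarith
  have h8 : |(1 + u) * r| ≤ 2 * (2 * δ ^ 3) := by
    rw [abs_mul]
    have : |1 + u| ≤ 2 := (abs_add_le 1 u).trans (by rw [abs_one]; linarith)
    gcongr
  rw [h5]
  refine (abs_sub _ _).trans ?_
  have : 0 ≤ δ ^ 3 := by positivity
  linarith

variable {M : ℕ} {d : Fin M → ℕ}

theorem lintegral_gibbsMeasure {U : State d → ℝ} (hU : Continuous U) (g : State d → ℝ≥0∞) :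
    ∫⁻ x, g x ∂gibbsMeasure U = ∫⁻ x, ENNReal.ofReal (Real.exp (-U x)) * g x :=
  lintegral_withDensity_eq_lintegral_mul_non_measurable _
    (Real.continuous_exp.comp hU.neg).measurable.ennreal_ofReal (by simp) g

theorem integral_gibbsMeasure {U : State d → ℝ} (hU : Continuous U) (g : State d → ℝ) :
    ∫ x, g x ∂gibbsMeasure U = ∫ x, g x * Real.exp (-U x) := by
  have hm : Measurable fun x => ENNReal.ofReal (Real.exp (-U x)) :=
    (Real.continuous_exp.comp hU.neg).measurable.ennreal_ofReal
  rw [gibbsMeasure, integral_withDensity_eq_integral_toReal_smul hm (by simp)]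
  simp [ENNReal.toReal_ofReal (Real.exp_pos _).le, mul_comm]

variable {U U₀ : State d → ℝ} {V : (m : Fin M) → EuclideanSpace ℝ (Fin (d m)) → ℝ}
  {L : Fin M → ℝ≥0} {lam : ℝ}

/-- The relative densities produced by displacing one block at a time along the transport. -/
theorem IsBlockConvexSmooth.exists_displacement_weights (hU : IsBlockConvexSmooth U U₀ V L lam)
    (hlam : lam ≤ 1) [IsProbabilityMeasure (gibbsMeasure U)] {h : State d → ℝ}
    {g : Fin M → State d → ℝ} {c C : ℝ} (hc : 0 < c) (hh : Continuous h)
    (hhc : ∀ x, h x ∈ Set.Icc c C) (hh1 : ∫ x, h x ∂gibbsMeasure U = 1)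
    (hg : ∀ m, Measurable (g m)) (hgc : ∀ m x, g m x ∈ Set.Icc c C)
    (hg1 : ∀ m, ∫ x, g m x ∂gibbsMeasure U = 1)
    (hgu : ∀ m x y, g m (Function.update x m y) = g m x) :
    ∃ w : Fin M → State d → ℝ, (∀ m, Measurable (w m)) ∧ (∀ m x, 0 < w m x) ∧
      (∀ m, ∫⁻ x, ENNReal.ofReal (w m x) ∂gibbsMeasure U ≤ 1) ∧
      ∀ x, ∑ m, Real.log (g m x) - (M - lam) * Real.log (h x) ≤
        ∑ m, Real.log (w m x / h x) := by
  have hh0 : ∀ x, 0 < h x := fun x => hc.trans_le (hhc x).1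
  have hg0 : ∀ m x, 0 < g m x := fun m x => hc.trans_le (hgc m x).1
  have hσ := hU.isDominatedStateDensity_exp
  have hρ : IsDominatedStateDensity fun x => h x * Real.exp (-U x) := by
    obtain ⟨K, hK⟩ := hσ.bound
    refine ⟨hh.mul hσ.continuous, fun x => mul_pos (hh0 x) (Real.exp_pos _), C * K, fun x => ?_⟩
    rw [mul_assoc]
    exact mul_le_mul (hhc x).2 (hK x) (Real.exp_pos _).le ((hh0 x).le.trans (hhc x).2)
  have heq : ∫ x, h x * Real.exp (-U x) = ∫ x, Real.exp (-U x) := by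
    rw [← integral_gibbsMeasure hU.continuous, hh1]
    have := integral_gibbsMeasure hU.continuous fun _ => 1
    simpa using this
  obtain ⟨T, D, hT, hD, hD0, hprod, harea⟩ := exists_block_transport hρ hσ heq
  have hUm : Measurable U := hU.continuous.measurable
  set S : Fin M → State d → State d :=
    fun m x => Function.update x m ((1 - lam) • x m + lam • T x m) with hS
  have hSm : ∀ m, Measurable (S m) := by
    intro m
    have h1 : Measurable fun x : State d => x m := measurable_pi_apply m
    have h2 : Measurable fun x : State d => T x m := h1.comp hT
    have h3 : Measurable fun x : State d => (1 - lam) • x m + lam • T x m :=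
      (h1.const_smul (1 - lam)).add (h2.const_smul lam)
    exact (measurable_updateBlock m).comp (measurable_id.prodMk h3)
  set w : Fin M → State d → ℝ :=
    fun m x => g m x * D x m ^ lam * Real.exp (-U (S m x)) * Real.exp (U x) with hw
  have hw0 : ∀ m x, 0 < w m x := fun m x => by
    have := Real.rpow_pos_of_pos (hD0 x m) lam
    have := hg0 m x
    positivity
  have hwm : ∀ m, Measurable (w m) := fun m =>
    (((hg m).mul (((measurable_pi_apply m).comp hD).pow_const _)).mul
      (hUm.comp (hSm m)).neg.exp).mul hUm.exp
  have hw1 : ∀ m, ∫⁻ x, ENNReal.ofReal (w m x) ∂gibbsMeasure U ≤ 1 := by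
    intro m
    have h1 := harea lam ⟨hU.lam_pos.le, hlam⟩ m
      (fun x => ENNReal.ofReal (g m x * Real.exp (-U x))) ((hg m).mul hUm.neg.exp).ennreal_ofReal
    have h2 : ∫⁻ x, ENNReal.ofReal (g m x * Real.exp (-U x)) = 1 := by
      rw [← ofReal_integral_eq_lintegral_ofReal, ← integral_gibbsMeasure hU.continuous, hg1,
        ENNReal.ofReal_one]
      · refine (hσ.integrable.const_mul C).mono' ((hg m).mul hUm.neg.exp).aestronglyMeasurable
          (Filter.Eventually.of_forall fun x => ?_)
        rw [Real.norm_of_nonneg (mul_pos (hg0 m x) (Real.exp_pos _)).le]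
        exact mul_le_mul_of_nonneg_right (hgc m x).2 (Real.exp_pos _).le
      · exact Filter.Eventually.of_forall fun x => (mul_pos (hg0 m x) (Real.exp_pos _)).le
    rw [h2] at h1
    refine le_trans (le_of_eq ?_) h1
    rw [lintegral_gibbsMeasure hU.continuous]
    refine lintegral_congr fun x => ?_
    rw [← ENNReal.ofReal_mul (Real.exp_pos _).le,
      ← ENNReal.ofReal_mul (mul_pos (hg0 m _) (Real.exp_pos _)).le, hgu]
    congr 1
    have : Real.exp (-U x) * Real.exp (U x) = 1 := by rw [← Real.exp_add]; simp
    simp only [hw]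
    linear_combination (g m x * D x m ^ lam * Real.exp (-U (S m x))) * this
  refine ⟨w, hwm, hw0, hw1, fun x => ?_⟩
  have hlog : ∀ m, Real.log (w m x / h x) = Real.log (g m x) + lam * Real.log (D x m) -
      U (S m x) + U x - Real.log (h x) := by
    intro m
    have h1 := (Real.rpow_pos_of_pos (hD0 x m) lam).ne'
    have h2 := (hg0 m x).ne'
    rw [Real.log_div (hw0 m x).ne' (hh0 x).ne', Real.log_mul (by positivity) (by positivity),
      Real.log_mul (by positivity) (by positivity), Real.log_mul h2 h1, Real.log_exp,
      Real.log_exp, Real.log_rpow (hD0 x m)]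
    ring
  -- Logarithm of the Jacobian equation.
  have hsumD : ∑ m, Real.log (D x m) = Real.log (h x) - U x + U (T x) := by
    have h1 := congrArg Real.log (hprod x)
    rw [Real.log_mul (Finset.prod_pos fun m _ => hD0 x m).ne' (Real.exp_pos _).ne',
      Real.log_prod fun m _ => (hD0 x m).ne', Real.log_exp,
      Real.log_mul (hh0 x).ne' (Real.exp_pos _).ne', Real.log_exp] at h1
    linarith
  have hsum : ∑ m, Real.log (w m x / h x) = ∑ m, Real.log (g m x) +
      lam * (Real.log (h x) - U x + U (T x)) - ∑ m, U (S m x) + M * U x -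
        M * Real.log (h x) := by
    simp only [hlog, Finset.sum_add_distrib, Finset.sum_sub_distrib, ← Finset.mul_sum, hsumD,
      Finset.sum_const, Finset.card_univ, Fintype.card_fin, nsmul_eq_mul]
  have h1 := hU.sum_update_le hlam x (T x)
  rw [hsum]
  simp only [hS]
  linarith

/-- The entropy inequality for a density `h` and functions `g m` not depending on the `m`-th block. -/
theorem IsBlockConvexSmooth.sum_integral_mul_log_le (hU : IsBlockConvexSmooth U U₀ V L lam)
    (hlam : lam ≤ 1) [IsProbabilityMeasure (gibbsMeasure U)] {h : State d → ℝ}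
    {g : Fin M → State d → ℝ} {c C : ℝ} (hc : 0 < c) (hh : Continuous h)
    (hhc : ∀ x, h x ∈ Set.Icc c C) (hh1 : ∫ x, h x ∂gibbsMeasure U = 1)
    (hg : ∀ m, Measurable (g m)) (hgc : ∀ m x, g m x ∈ Set.Icc c C)
    (hg1 : ∀ m, ∫ x, g m x ∂gibbsMeasure U = 1)
    (hgu : ∀ m x y, g m (Function.update x m y) = g m x) :
    ∑ m, ∫ x, h x * Real.log (g m x) ∂gibbsMeasure U ≤
      (M - lam) * ∫ x, h x * Real.log (h x) ∂gibbsMeasure U := by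
  have hh0 : ∀ x, 0 < h x := fun x => hc.trans_le (hhc x).1
  obtain ⟨w, hwm, hw0, hw1, hlog⟩ := hU.exists_displacement_weights hlam hc hh hhc hh1 hg hgc hg1 hgu
  have hwi : ∀ m, Integrable (w m) (gibbsMeasure U) := fun m =>
    ⟨(hwm m).aestronglyMeasurable, by
      rw [hasFiniteIntegral_iff_ofReal (Filter.Eventually.of_forall fun x => (hw0 m x).le)]
      exact (hw1 m).trans_lt ENNReal.one_lt_top⟩
  have hwint : ∀ m, ∫ x, w m x ∂gibbsMeasure U ≤ 1 := fun m => by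
    rw [integral_eq_lintegral_of_nonneg_ae (Filter.Eventually.of_forall fun x => (hw0 m x).le)
      (hwm m).aestronglyMeasurable]
    exact ENNReal.toReal_le_of_le_ofReal zero_le_one (by simpa using hw1 m)
  have hlogC : ∀ r ∈ Set.Icc c C, |Real.log r| ≤ |Real.log c| + |Real.log C| := by
    intro r hr
    have h1 := Real.log_le_log hc hr.1
    have h2 := Real.log_le_log (hc.trans_le hr.1) hr.2
    rw [abs_le]
    constructor
    · linarith [neg_abs_le (Real.log c), abs_nonneg (Real.log C)]
    · linarith [le_abs_self (Real.log C), abs_nonneg (Real.log c)]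
  have hint : ∀ r : State d → ℝ, Measurable r → (∀ x, r x ∈ Set.Icc c C) →
      Integrable (fun x => h x * Real.log (r x)) (gibbsMeasure U) := by
    intro r hr hrc
    refine Integrable.of_bound (hh.measurable.mul hr.log).aestronglyMeasurable
      (C * (|Real.log c| + |Real.log C|)) (Filter.Eventually.of_forall fun x => ?_)
    rw [norm_mul, Real.norm_of_nonneg (hh0 x).le, Real.norm_eq_abs]
    exact mul_le_mul (hhc x).2 (hlogC _ (hrc x)) (abs_nonneg _) ((hh0 x).le.trans (hhc x).2)
  have hhi : Integrable h (gibbsMeasure U) :=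
    Integrable.of_bound hh.aestronglyMeasurable C (Filter.Eventually.of_forall fun x => by
      rw [Real.norm_of_nonneg (hh0 x).le]; exact (hhc x).2)
  -- Here log r ≤ r - 1 is used at r = w m x / h x. The right side integrates to at most 0 because
  -- each w m has mass at most 1 and h has mass 1.
  have hpt : ∀ x, ∑ m, h x * Real.log (g m x) - (M - lam) * (h x * Real.log (h x)) ≤
      ∑ m, (w m x - h x) := by
    intro x
    have h2 : ∑ m, Real.log (w m x / h x) ≤ ∑ m, (w m x / h x - 1) :=
      Finset.sum_le_sum fun m _ => Real.log_le_sub_one_of_pos (div_pos (hw0 m x) (hh0 x))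
    have h3 : ∑ m, Real.log (g m x) - (M - lam) * Real.log (h x) ≤ ∑ m, (w m x / h x - 1) := by
      exact (hlog x).trans h2
    have h4 := mul_le_mul_of_nonneg_left h3 (hh0 x).le
    rw [mul_sub, Finset.mul_sum, Finset.mul_sum] at h4
    refine le_trans (le_of_eq (by ring)) (h4.trans (le_of_eq ?_))
    refine Finset.sum_congr rfl fun m _ => ?_
    rw [mul_sub, mul_div_cancel₀ _ (hh0 x).ne', mul_one]
  have hL1 : Integrable (fun x => ∑ m, h x * Real.log (g m x)) (gibbsMeasure U) :=
    integrable_finsetSum _ fun m _ => hint (g m) (hg m) (hgc m)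
  have hL2 : Integrable (fun x => (M - lam) * (h x * Real.log (h x))) (gibbsMeasure U) :=
    (hint h hh.measurable hhc).const_mul _
  have hR : ∀ m, Integrable (fun x => w m x - h x) (gibbsMeasure U) := fun m => (hwi m).sub hhi
  have hfin : ∫ x, (∑ m, h x * Real.log (g m x) - (M - lam) * (h x * Real.log (h x)))
      ∂gibbsMeasure U ≤ ∫ x, ∑ m, (w m x - h x) ∂gibbsMeasure U :=
    integral_mono (hL1.sub hL2) (integrable_finsetSum _ fun m _ => hR m) hpt
  rw [integral_sub hL1 hL2, integral_finsetSum _ fun m _ => hint (g m) (hg m) (hgc m),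
    integral_const_mul, integral_finsetSum _ fun m _ => hR m] at hfin
  have hle : ∑ m, ∫ x, (w m x - h x) ∂gibbsMeasure U ≤ 0 := Finset.sum_nonpos fun m _ => by
    rw [integral_sub (hwi m) hhi, hh1]
    linarith [hwint m]
  linarith

/-- The linearization of the entropy inequality at the constant density. -/
theorem IsBlockConvexSmooth.sum_integral_sq_le (hU : IsBlockConvexSmooth U U₀ V L lam)
    (hlam : lam ≤ 1) (hM : 0 < M) [IsProbabilityMeasure (gibbsMeasure U)] {f : State d → ℝ}
    {p : Fin M → State d → ℝ} {K : ℝ} (hf : Continuous f) (hfK : ∀ x, |f x| ≤ K)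
    (hf0 : ∫ x, f x ∂gibbsMeasure U = 0)
    (hp : ∀ m, Measurable (p m)) (hpK : ∀ m x, |p m x| ≤ K)
    (hp0 : ∀ m, ∫ x, p m x ∂gibbsMeasure U = 0)
    (hpu : ∀ m x y, p m (Function.update x m y) = p m x)
    (hfp : ∀ m, ∫ x, f x * p m x ∂gibbsMeasure U = ∫ x, p m x ^ 2 ∂gibbsMeasure U) :
    ∑ m, ∫ x, p m x ^ 2 ∂gibbsMeasure U ≤ (M - lam) * ∫ x, f x ^ 2 ∂gibbsMeasure U := by
  have hK : 0 ≤ K := (abs_nonneg _).trans (hfK 0)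
  -- Order ε vanishes since q is centred. Order ε² is ∫ f q - ½ ∫ q² = ½ ∫ q². The cases q = f and q
  -- = p m serve the two sides.
  have hexp : ∀ ε : ℝ, 0 < ε → ε * K ≤ 1 / 2 → ∀ q : State d → ℝ, Measurable q →
      (∀ x, |q x| ≤ K) → ∫ x, q x ∂gibbsMeasure U = 0 →
      ∫ x, f x * q x ∂gibbsMeasure U = ∫ x, q x ^ 2 ∂gibbsMeasure U →
      |∫ x, (1 + ε * f x) * Real.log (1 + ε * q x) ∂gibbsMeasure U -
        ε ^ 2 / 2 * ∫ x, q x ^ 2 ∂gibbsMeasure U| ≤ 7 * (ε * K) ^ 3 := by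
    intro ε hε hεK q hq hqK hq0 hfq
    have hb : ∀ (r : State d → ℝ), (∀ x, |r x| ≤ K) → ∀ x, |ε * r x| ≤ ε * K := fun r hr x => by
      rw [abs_mul, abs_of_pos hε]
      gcongr
      exact hr x
    have hqi : Integrable q (gibbsMeasure U) := Integrable.of_bound hq.aestronglyMeasurable K
      (Filter.Eventually.of_forall hqK)
    have hq2 : Integrable (fun x => q x ^ 2) (gibbsMeasure U) :=
      Integrable.of_bound (hq.pow_const 2).aestronglyMeasurable (K ^ 2)
        (Filter.Eventually.of_forall fun x => by
          rw [norm_pow, Real.norm_eq_abs]; gcongr; exact hqK x)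
    have hfqi : Integrable (fun x => f x * q x) (gibbsMeasure U) :=
      Integrable.of_bound (hf.measurable.mul hq).aestronglyMeasurable (K * K)
        (Filter.Eventually.of_forall fun x => by
          rw [norm_mul, Real.norm_eq_abs, Real.norm_eq_abs]; gcongr; exacts [hfK x, hqK x])
    set Φ : State d → ℝ := fun x => ε * q x + ε ^ 2 * (f x * q x) - ε ^ 2 / 2 * q x ^ 2 with hΦ
    have hΦi : Integrable Φ (gibbsMeasure U) :=
      ((hqi.const_mul ε).add (hfqi.const_mul _)).sub (hq2.const_mul _)
    have hΦint : ∫ x, Φ x ∂gibbsMeasure U = ε ^ 2 / 2 * ∫ x, q x ^ 2 ∂gibbsMeasure U := by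
      have hadd : Integrable (fun x => ε * q x + ε ^ 2 * (f x * q x)) (gibbsMeasure U) :=
        (hqi.const_mul ε).add (hfqi.const_mul _)
      simp only [hΦ]
      rw [integral_sub hadd (hq2.const_mul _),
        integral_add (hqi.const_mul ε) (hfqi.const_mul _), integral_const_mul, integral_const_mul,
        integral_const_mul, hq0, hfq]
      ring
    have hdiff : ∀ x, |(1 + ε * f x) * Real.log (1 + ε * q x) - Φ x| ≤ 7 * (ε * K) ^ 3 := by
      intro x
      refine le_trans (le_of_eq ?_) (abs_mul_log_sub_le (hb f hfK x) (hb q hqK x) hεK)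
      simp only [hΦ]
      congr 1
      ring
    have hmeas : Measurable fun x => (1 + ε * f x) * Real.log (1 + ε * q x) :=
      ((hf.measurable.const_mul _).const_add _).mul ((hq.const_mul _).const_add _).log
    have hdi : Integrable (fun x => (1 + ε * f x) * Real.log (1 + ε * q x) - Φ x)
        (gibbsMeasure U) := Integrable.of_bound (hmeas.aestronglyMeasurable.sub
          hΦi.aestronglyMeasurable) _ (Filter.Eventually.of_forall hdiff)
    have hi : Integrable (fun x => (1 + ε * f x) * Real.log (1 + ε * q x)) (gibbsMeasure U) := by
      have := hdi.add hΦi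
      refine this.congr (Filter.Eventually.of_forall fun x => ?_)
      simp
    rw [← hΦint, ← integral_sub hi hΦi]
    have := norm_integral_le_of_norm_le_const (μ := gibbsMeasure U)
      (f := fun x => (1 + ε * f x) * Real.log (1 + ε * q x) - Φ x)
      (Filter.Eventually.of_forall hdiff)
    simpa using this
  -- Each side contributes an error of at most 7 M (εK)³; dividing the total by ε² / 2 gives 28.
  have hmain : ∀ ε : ℝ, 0 < ε → ε * K ≤ 1 / 2 → ∑ m, ∫ x, p m x ^ 2 ∂gibbsMeasure U ≤
      (M - lam) * ∫ x, f x ^ 2 ∂gibbsMeasure U + ε * (28 * M * K ^ 3) := by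
    intro ε hε hεK
    have hIcc : ∀ (r : State d → ℝ), (∀ x, |r x| ≤ K) → ∀ x,
        1 + ε * r x ∈ Set.Icc (1 / 2 : ℝ) 2 := by
      intro r hr x
      have h1 : |ε * r x| ≤ 1 / 2 := by
        rw [abs_mul, abs_of_pos hε]
        exact (mul_le_mul_of_nonneg_left (hr x) hε.le).trans hεK
      have := abs_le.1 h1
      constructor <;> linarith
    have hone : ∀ (r : State d → ℝ), Measurable r → (∀ x, |r x| ≤ K) →
        ∫ x, r x ∂gibbsMeasure U = 0 → ∫ x, (1 + ε * r x) ∂gibbsMeasure U = 1 := by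
      intro r hr hrK hr0
      rw [integral_add (integrable_const _) ((Integrable.of_bound hr.aestronglyMeasurable K
        (Filter.Eventually.of_forall hrK)).const_mul _), integral_const_mul, hr0]
      simp
    have h1 := hU.sum_integral_mul_log_le hlam (h := fun x => 1 + ε * f x)
      (g := fun m x => 1 + ε * p m x) one_half_pos (by fun_prop) (hIcc f hfK)
      (hone f hf.measurable hfK hf0) (fun m => ((hp m).const_mul _).const_add _)
      (fun m => hIcc _ (hpK m)) (fun m => hone _ (hp m) (hpK m) (hp0 m))
      (fun m x y => by rw [hpu])
    have h2 := hexp ε hε hεK f hf.measurable hfK hf0 (by simp only [sq])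
    have h3 : ∑ m, (ε ^ 2 / 2 * ∫ x, p m x ^ 2 ∂gibbsMeasure U - 7 * (ε * K) ^ 3) ≤
        ∑ m, ∫ x, (1 + ε * f x) * Real.log (1 + ε * p m x) ∂gibbsMeasure U :=
      Finset.sum_le_sum fun m _ => by
        have := (abs_le.1 (hexp ε hε hεK (p m) (hp m) (hpK m) (hp0 m) (hfp m))).1
        linarith
    rw [Finset.sum_sub_distrib, ← Finset.mul_sum, Finset.sum_const, Finset.card_univ,
      Fintype.card_fin, nsmul_eq_mul] at h3
    have hM1 : (1 : ℝ) ≤ M := by exact_mod_cast hM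
    have h4 := mul_le_mul_of_nonneg_left (abs_le.1 h2).2 (by linarith : (0 : ℝ) ≤ M - lam)
    have h5 : (M - lam) * (7 * (ε * K) ^ 3) ≤ M * (7 * (ε * K) ^ 3) := by
      have := hU.lam_pos
      gcongr
      linarith
    have h6 : ε ^ 2 / 2 * ∑ m, ∫ x, p m x ^ 2 ∂gibbsMeasure U ≤ ε ^ 2 / 2 *
        ((M - lam) * ∫ x, f x ^ 2 ∂gibbsMeasure U + ε * (28 * M * K ^ 3)) := by
      have : (ε * K) ^ 3 = ε ^ 2 * (ε * K ^ 3) := by ring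
      rw [this] at h3 h4 h5
      linarith
    exact le_of_mul_le_mul_left h6 (by positivity)
  refine le_of_forall_pos_le_add fun η hη => ?_
  set B : ℝ := 28 * M * K ^ 3 with hB
  have hB0 : 0 ≤ B := by positivity
  -- The first bound ensures ε K ≤ 1 / 2 and the second an error of at most η. Adding 1 covers K = 0
  -- and B = 0.
  have h1 := hmain (min (1 / (2 * (K + 1))) (η / (B + 1)))
    (lt_min (by positivity) (by positivity)) (by
      calc _ ≤ 1 / (2 * (K + 1)) * K := by gcongr; exact min_le_left _ _
        _ ≤ 1 / 2 := by
          rw [div_mul_eq_mul_div, div_le_div_iff₀ (by positivity) two_pos]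
          linarith)
  refine h1.trans ?_
  gcongr
  calc _ ≤ η / (B + 1) * B := by gcongr; exact min_le_right _ _
    _ ≤ η := by
      rw [div_mul_eq_mul_div, div_le_iff₀ (by positivity)]
      nlinarith

end Entropy

/-! ### Conditional variances, density in L² and change of probability space -/

section ConditionalVariance

variable {Ω : Type*} {m₀ : MeasurableSpace Ω} {μ : Measure Ω} [IsProbabilityMeasure μ]

theorem integral_condVar_eq_integral_sub_sq {𝓜 : MeasurableSpace Ω} (hm : 𝓜 ≤ m₀) (f : Ω → ℝ) :
    ∫ x, (Var[f; μ | 𝓜]) x ∂μ = ∫ x, (f x - (μ[f | 𝓜]) x) ^ 2 ∂μ := by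
  rw [condVar, integral_condExp hm]
  rfl

theorem integral_condVar_nonneg {𝓜 : MeasurableSpace Ω} (hm : 𝓜 ≤ m₀) (f : Ω → ℝ) :
    0 ≤ ∫ x, (Var[f; μ | 𝓜]) x ∂μ := by
  rw [integral_condVar_eq_integral_sub_sq hm]
  exact integral_nonneg fun x => sq_nonneg _

/-- As a squared distance to a projection, the mean conditional variance is continuous on L², which
the density argument needs. -/
theorem integral_condVar_eq_norm_sq {𝓜 : MeasurableSpace Ω} (hm : 𝓜 ≤ m₀) {f : Ω → ℝ}
    (hf : MemLp f 2 μ) : ∫ x, (Var[f; μ | 𝓜]) x ∂μ =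
      ‖hf.toLp f - (condExpL2 ℝ ℝ hm (hf.toLp f) : Lp ℝ 2 μ)‖ ^ 2 := by
  rw [integral_condVar_eq_integral_sub_sq hm, ← real_inner_self_eq_norm_sq, L2.inner_def]
  refine integral_congr_ae ?_
  filter_upwards [hf.condExpL2_ae_eq_condExp (𝕜 := ℝ) hm, hf.coeFn_toLp,
    Lp.coeFn_sub (hf.toLp f) (condExpL2 ℝ ℝ hm (hf.toLp f) : Lp ℝ 2 μ)] with x h1 h2 h3
  rw [h3, Pi.sub_apply, h1, h2, real_inner_self_eq_norm_sq, Real.norm_eq_abs, sq_abs]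

theorem integral_mul_condExp {𝓜 : MeasurableSpace Ω} (hm : 𝓜 ≤ m₀) {f : Ω → ℝ}
    (hf : MemLp f 2 μ) :
    ∫ x, f x * (μ[f | 𝓜]) x ∂μ = ∫ x, (μ[f | 𝓜]) x ^ 2 ∂μ := by
  have h1 : Integrable (f * μ[f | 𝓜]) μ :=
    hf.integrable_mul (hf.condExp one_le_two)
  have h2 := condExp_mul_of_stronglyMeasurable_right stronglyMeasurable_condExp h1
    (hf.integrable one_le_two)
  calc _ = ∫ x, (μ[f * μ[f | 𝓜] | 𝓜]) x ∂μ := (integral_condExp hm).symm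
    _ = _ := integral_congr_ae (by
      filter_upwards [h2] with x hx
      rw [hx, Pi.mul_apply, sq])

theorem integral_condVar_eq_sub {𝓜 : MeasurableSpace Ω} (hm : 𝓜 ≤ m₀) {f : Ω → ℝ}
    (hf : MemLp f 2 μ) :
    ∫ x, (Var[f; μ | 𝓜]) x ∂μ = ∫ x, f x ^ 2 ∂μ - ∫ x, (μ[f | 𝓜]) x ^ 2 ∂μ := by
  have h1 : Integrable (fun x => f x * (μ[f | 𝓜]) x) μ :=
    hf.integrable_mul (hf.condExp one_le_two)
  have h2 := hf.integrable_sq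
  have h3 : Integrable (fun x => (μ[f | 𝓜]) x ^ 2) μ := (hf.condExp one_le_two).integrable_sq
  have h4 : ∀ x, (f x - (μ[f | 𝓜]) x) ^ 2 =
      f x ^ 2 - 2 * (f x * (μ[f | 𝓜]) x) + (μ[f | 𝓜]) x ^ 2 := fun x => by ring
  have h5 : Integrable (fun x => f x ^ 2 - 2 * (f x * (μ[f | 𝓜]) x)) μ := h2.sub (h1.const_mul 2)
  rw [integral_condVar_eq_integral_sub_sq hm]
  simp only [h4]
  rw [integral_add h5 h3, integral_sub h2 (h1.const_mul 2), integral_const_mul,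
    integral_mul_condExp hm hf]
  ring

theorem integral_condVar_sub_const {𝓜 : MeasurableSpace Ω} (hm : 𝓜 ≤ m₀) {f : Ω → ℝ}
    (hf : Integrable f μ) (c : ℝ) :
    ∫ x, (Var[fun y => f y - c; μ | 𝓜]) x ∂μ = ∫ x, (Var[f; μ | 𝓜]) x ∂μ := by
  rw [integral_condVar_eq_integral_sub_sq hm, integral_condVar_eq_integral_sub_sq hm]
  refine integral_congr_ae ?_
  have h1 := condExp_sub hf (integrable_const c) (μ := μ) 𝓜
  rw [condExp_const hm] at h1
  filter_upwards [h1] with x hx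
  have h2 : (μ[fun y => f y - c | 𝓜]) x = (μ[f | 𝓜]) x - c := hx
  rw [h2]
  ring

/-- An inequality between variances and conditional variances extends from bounded continuous
functions to square integrable ones. -/
theorem mul_variance_le_of_boundedContinuous {ι : Type*} [Fintype ι] [TopologicalSpace Ω]
    [NormalSpace Ω] [BorelSpace Ω] [μ.WeaklyRegular] {𝓜 : ι → MeasurableSpace Ω}
    (hm : ∀ i, 𝓜 i ≤ m₀) {c : ℝ}
    (h : ∀ f : BoundedContinuousFunction Ω ℝ,
      c * Var[f; μ] ≤ ∑ i, ∫ x, (Var[f; μ | 𝓜 i]) x ∂μ)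
    {f : Ω → ℝ} (hf : MemLp f 2 μ) : c * Var[f; μ] ≤ ∑ i, ∫ x, (Var[f; μ | 𝓜 i]) x ∂μ := by
  -- The variance is the conditional variance for the trivial σ-algebra, so both sides of the
  -- inequality are continuous for the same reason.
  have hbot : ∀ {g : Ω → ℝ} (hg : MemLp g 2 μ), Var[g; μ] =
      ‖hg.toLp g - (condExpL2 ℝ ℝ bot_le (hg.toLp g) : Lp ℝ 2 μ)‖ ^ 2 := by
    intro g hg
    rw [← integral_condVar_eq_norm_sq, condVar_bot hg.aestronglyMeasurable.aemeasurable]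
    simp
  have key : ∀ g : Lp ℝ 2 μ, c * ‖g - (condExpL2 ℝ ℝ bot_le g : Lp ℝ 2 μ)‖ ^ 2 ≤
      ∑ i, ‖g - (condExpL2 ℝ ℝ (hm i) g : Lp ℝ 2 μ)‖ ^ 2 := by
    refine isClosed_property (BoundedContinuousFunction.toLp_denseRange ℝ μ ℝ
      ENNReal.ofNat_ne_top) (isClosed_le ?_ ?_) fun g => ?_
    · fun_prop
    · fun_prop
    · have hg : MemLp g 2 μ := by
        have := Lp.memLp (BoundedContinuousFunction.toLp 2 μ ℝ g)
        exact (memLp_congr_ae (BoundedContinuousFunction.coeFn_toLp 2 μ ℝ g)).1 this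
      have hgL : BoundedContinuousFunction.toLp 2 μ ℝ g = hg.toLp g := by
        refine Lp.ext ?_
        exact (BoundedContinuousFunction.coeFn_toLp 2 μ ℝ g).trans hg.coeFn_toLp.symm
      rw [hgL, ← hbot hg]
      simp only [← integral_condVar_eq_norm_sq]
      exact h g
  rw [hbot hf]
  simp only [integral_condVar_eq_norm_sq (hm _) hf]
  exact key _

variable {S : Type*} {𝓜 mS : MeasurableSpace S} {X : Ω → S}

/-- Reduces statements about a random variable X to its law: sets of the pulled-back σ-algebra are
preimages, on which integrals transfer through the image measure. -/
theorem condExp_comap_comp_ae_eq (hX : Measurable X) (hm : 𝓜 ≤ mS)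
    {f : S → ℝ} (hf : Integrable f (μ.map X)) :
    (fun ω => ((μ.map X)[f | 𝓜]) (X ω)) =ᵐ[μ] μ[fun ω => f (X ω) | 𝓜.comap X] := by
  have hle : 𝓜.comap X ≤ m₀ := (MeasurableSpace.comap_mono hm).trans hX.comap_le
  have := Measure.isProbabilityMeasure_map (μ := μ) hX.aemeasurable
  have hi : Integrable (fun ω => ((μ.map X)[f | 𝓜]) (X ω)) μ :=
    integrable_condExp.comp_measurable hX
  refine ae_eq_condExp_of_forall_setIntegral_eq hle (hf.comp_measurable hX)
    (fun s _ _ => hi.integrableOn) ?_ ?_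
  · rintro _ ⟨t, ht, rfl⟩ -
    rw [← setIntegral_map (hm t ht) integrable_condExp.aestronglyMeasurable hX.aemeasurable,
      ← setIntegral_map (hm t ht) hf.aestronglyMeasurable hX.aemeasurable,
      setIntegral_condExp hm hf ht]
  · refine StronglyMeasurable.aestronglyMeasurable ?_
    exact stronglyMeasurable_condExp.comp_measurable (Measurable.of_comap_le le_rfl)

theorem integral_condVar_comap (hX : Measurable X) (hm : 𝓜 ≤ mS)
    {f : S → ℝ} (hf : Integrable f (μ.map X)) :
    ∫ ω, (Var[fun ω => f (X ω); μ | 𝓜.comap X]) ω ∂μ =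
      ∫ x, (Var[f; μ.map X | 𝓜]) x ∂μ.map X := by
  have hle : 𝓜.comap X ≤ m₀ := (MeasurableSpace.comap_mono hm).trans hX.comap_le
  have := Measure.isProbabilityMeasure_map (μ := μ) hX.aemeasurable
  have hmeas : AEStronglyMeasurable (fun x => (f x - ((μ.map X)[f | 𝓜]) x) ^ 2) (μ.map X) :=
    (hf.aestronglyMeasurable.sub integrable_condExp.aestronglyMeasurable).pow 2
  rw [integral_condVar_eq_integral_sub_sq hle, integral_condVar_eq_integral_sub_sq hm,
    integral_map hX.aemeasurable hmeas]
  refine integral_congr_ae ?_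
  filter_upwards [condExp_comap_comp_ae_eq hX hm hf] with ω h
  rw [h]

end ConditionalVariance

/-! ### Block kernels as conditional expectations -/

section BlockAverage

variable {M : ℕ} {d : Fin M → ℕ}

/-- The σ-algebra on the state space generated by all the blocks but the `m`-th one. -/
abbrev sigmaCompl (m : Fin M) : MeasurableSpace (State d) :=
  MeasurableSpace.comap (dropBlock m) inferInstance

theorem sigmaCompl_le (m : Fin M) :
    sigmaCompl (d := d) m ≤ (inferInstance : MeasurableSpace (State d)) :=
  (measurable_dropBlock m).comap_le

/-- The state with given `m`-th block and given other blocks. -/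
def glueBlock (m : Fin M) (p : StateCompl d m × EuclideanSpace ℝ (Fin (d m))) : State d :=
  Function.update (fun i => if h : i ≠ m then p.1 ⟨i, h⟩ else 0) m p.2

theorem measurable_glueBlock (m : Fin M) : Measurable (glueBlock (d := d) m) := by
  have h : Measurable fun p : StateCompl d m × EuclideanSpace ℝ (Fin (d m)) =>
      (fun i => if h : i ≠ m then p.1 ⟨i, h⟩ else 0 : State d) := by
    refine measurable_pi_lambda _ fun i => ?_
    split_ifs with h
    · exact (measurable_pi_apply (⟨i, h⟩ : {i : Fin M // i ≠ m})).comp measurable_fst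
    · exact measurable_const
  exact (measurable_updateBlock m).comp (h.prodMk measurable_snd)

theorem glueBlock_dropBlock (m : Fin M) (x : State d) (y : EuclideanSpace ℝ (Fin (d m))) :
    glueBlock m (dropBlock m x, y) = Function.update x m y := by
  funext i
  rcases eq_or_ne i m with rfl | h
  · simp [glueBlock]
  · simp [glueBlock, h, dropBlock]

theorem dropBlock_update (m : Fin M) (x : State d) (y : EuclideanSpace ℝ (Fin (d m))) :
    dropBlock m (Function.update x m y) = dropBlock m x := by
  funext i
  simp [dropBlock, i.2]

/-- Identifies a state with the pair (x_{-m}, x_m), the form in which disintegration along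
`condDistrib` applies. -/
theorem measurableEmbedding_split (m : Fin M) :
    MeasurableEmbedding fun x : State d => (dropBlock m x, x m) := by
  refine (⟨⟨fun x => (dropBlock m x, x m), glueBlock m, fun x => ?_, fun p => ?_⟩,
    (measurable_dropBlock m).prodMk (measurable_pi_apply m), measurable_glueBlock m⟩ :
      State d ≃ᵐ StateCompl d m × EuclideanSpace ℝ (Fin (d m))).measurableEmbedding
  · simp [glueBlock_dropBlock]
  · refine Prod.ext ?_ (by simp [glueBlock])
    simp only [glueBlock, dropBlock_update]
    funext i
    simp [dropBlock, i.2]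

theorem integrable_comp_glueBlock {π : Measure (State d)} (m : Fin M) {f : State d → ℝ}
    (hf : Integrable f π) : Integrable (fun p => f (glueBlock m p)) (π.map fun x => (dropBlock m x, x m)) := by
  rw [(measurableEmbedding_split m).integrable_map_iff]
  simpa [Function.comp_def, glueBlock_dropBlock] using hf

variable (π : Measure (State d)) [IsProbabilityMeasure π]

instance isMarkovKernel_fullConditional (m : Fin M) : IsMarkovKernel (fullConditional π m) := by
  unfold fullConditional
  infer_instance

/-- The average of `f` over the `m`-th block, given the other ones. -/
noncomputable def blockAverage (m : Fin M) (f : State d → ℝ) (x : State d) : ℝ :=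
  ∫ y, f (Function.update x m y) ∂fullConditional π m (dropBlock m x)

theorem blockKernel_eq_map (m : Fin M) (x : State d) :
    blockKernel π m x = (fullConditional π m (dropBlock m x)).map (Function.update x m) := by
  ext A hA
  have hu : Measurable (Function.update x m) := (measurable_updateBlock m).comp measurable_prodMk_left
  rw [blockKernel_apply π m x hA, Measure.map_apply hu hA, ← lintegral_indicator_one (hu hA)]
  rfl

theorem measurableEmbedding_update (m : Fin M) (x : State d) :
    MeasurableEmbedding (Function.update x m) :=
  (isClosedEmbedding_update x m).measurableEmbedding

theorem integral_blockKernel (m : Fin M) (f : State d → ℝ) (x : State d) :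
    ∫ y, f y ∂blockKernel π m x = blockAverage π m f x := by
  rw [blockKernel_eq_map, (measurableEmbedding_update m x).integral_map]
  rfl

variable {π}

theorem blockAverage_ae_eq_condExp (m : Fin M) {f : State d → ℝ} (hf : Integrable f π) :
    blockAverage π m f =ᵐ[π] π[f | sigmaCompl m] := by
  have h := condExp_prod_ae_eq_integral_condDistrib' (measurable_dropBlock m)
    (measurable_pi_apply m).aemeasurable (integrable_comp_glueBlock m hf)
  simp only [glueBlock_dropBlock, Function.update_eq_self] at h
  exact h.symm

theorem ae_integrable_blockKernel (m : Fin M) {f : State d → ℝ} (hf : Integrable f π) :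
    ∀ᵐ x ∂π, Integrable f (blockKernel π m x) := by
  have h := (integrable_comp_glueBlock m hf).condDistrib_ae
    (measurable_dropBlock m).aemeasurable (measurable_pi_apply m).aemeasurable
  filter_upwards [h] with x hx
  rw [blockKernel_eq_map, (measurableEmbedding_update m x).integrable_map_iff]
  simp only [glueBlock_dropBlock] at hx
  exact hx

theorem blockAverage_update (m : Fin M) (f : State d → ℝ) (x : State d)
    (y : EuclideanSpace ℝ (Fin (d m))) :
    blockAverage π m f (Function.update x m y) = blockAverage π m f x := by
  simp [blockAverage, dropBlock_update]

theorem measurable_blockAverage (m : Fin M) {f : State d → ℝ} (hf : Measurable f) :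
    Measurable (blockAverage π m f) := by
  have h := (hf.comp (measurable_glueBlock m)).stronglyMeasurable.integral_condDistrib
    (μ := π) (X := dropBlock m) (Y := fun x : State d => x m)
  have h2 := h.measurable.comp (measurable_dropBlock m)
  simp only [Function.comp_def, glueBlock_dropBlock] at h2
  exact h2

theorem abs_blockAverage_le (m : Fin M) {f : State d → ℝ} {K : ℝ} (hf : ∀ x, |f x| ≤ K)
    (x : State d) : |blockAverage π m f x| ≤ K := by
  have := norm_integral_le_of_norm_le_const (μ := fullConditional π m (dropBlock m x))
    (f := fun y => f (Function.update x m y)) (C := K) (Filter.Eventually.of_forall fun y => hf _)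
  simpa [blockAverage] using this

end BlockAverage

/-! ### Variance inequality and Dirichlet form -/

section SpectralGap

variable {M : ℕ} {d : Fin M → ℕ} {lam : ℝ}

/-- The linearized inequality is applied to f - E f and its block averages. The latter are
everywhere-defined versions of the conditional expectations, bounded and independent of block m at
every point. -/
theorem IsBlockConvexSmooth.mul_variance_le_of_boundedContinuous {U U₀ : State d → ℝ}
    {V : (m : Fin M) → EuclideanSpace ℝ (Fin (d m)) → ℝ} {L : Fin M → ℝ≥0}
    (hU : IsBlockConvexSmooth U U₀ V L lam) (hlam : lam ≤ 1) (hM : 0 < M)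
    [IsProbabilityMeasure (gibbsMeasure U)] (f : BoundedContinuousFunction (State d) ℝ) :
    lam * Var[f; gibbsMeasure U] ≤ ∑ m, ∫ x, (Var[f; gibbsMeasure U |
      sigmaCompl m]) x ∂gibbsMeasure U := by
  set π := gibbsMeasure U with hπ
  set c := ∫ x, f x ∂π with hc
  set g : State d → ℝ := fun x => f x - c with hg
  have hgc : Continuous g := f.continuous.sub continuous_const
  have hgK : ∀ x, |g x| ≤ ‖f‖ + |c| := fun x =>
    (abs_sub _ _).trans (add_le_add_left (f.norm_coe_le_norm x) _)
  have hfi : Integrable f π := f.integrable π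
  have hg2 : MemLp g 2 π :=
    MemLp.of_bound hgc.aestronglyMeasurable _ (Filter.Eventually.of_forall hgK)
  have hgi : Integrable g π := hg2.integrable one_le_two
  have hg0 : ∫ x, g x ∂π = 0 := by
    rw [integral_sub hfi (integrable_const c)]
    simp [hc]
  have hvar : Var[f; π] = ∫ x, g x ^ 2 ∂π := by
    rw [← variance_sub_const f.continuous.aestronglyMeasurable c,
      variance_of_integral_eq_zero hgc.aemeasurable hg0]
  have hae := fun m => blockAverage_ae_eq_condExp m hgi
  have hsq : ∀ m, ∫ x, blockAverage π m g x ^ 2 ∂π =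
      ∫ x, (π[g | sigmaCompl m]) x ^ 2 ∂π := fun m =>
    integral_congr_ae (by filter_upwards [hae m] with x hx; rw [hx])
  have hmain : ∑ m, ∫ x, blockAverage π m g x ^ 2 ∂π ≤ (M - lam) * ∫ x, g x ^ 2 ∂π :=
    hU.sum_integral_sq_le hlam hM (p := fun m => blockAverage π m g) hgc hgK hg0
    (fun m => measurable_blockAverage m hgc.measurable) (fun m => abs_blockAverage_le m hgK)
    (fun m => by
      rw [integral_congr_ae (hae m), integral_condExp (sigmaCompl_le m), hg0])
    (fun m => blockAverage_update m g) (fun m => by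
      rw [hsq, ← integral_mul_condExp (sigmaCompl_le m) hg2]
      exact integral_congr_ae (by filter_upwards [hae m] with x hx; rw [hx]))
  simp only [hsq] at hmain
  have hcv : ∀ m, ∫ x, (Var[f; π | sigmaCompl m]) x ∂π =
      ∫ x, g x ^ 2 ∂π -
        ∫ x, (π[g | sigmaCompl m]) x ^ 2 ∂π := fun m => by
    rw [← integral_condVar_sub_const (sigmaCompl_le m) hfi c,
      integral_condVar_eq_sub (sigmaCompl_le m) hg2]
  rw [Finset.sum_congr rfl fun m _ => hcv m, Finset.sum_sub_distrib, Finset.sum_const,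
    Finset.card_univ, Fintype.card_fin, nsmul_eq_mul, hvar]
  linarith

/-- Approximate tensorization of the variance. -/
theorem BlockAssumption.mul_variance_le {π : Measure (State d)} [IsProbabilityMeasure π]
    (h : BlockAssumption π lam) (hM : 0 < M) {f : State d → ℝ} (hf : MemLp f 2 π) :
    lam * Var[f; π] ≤
      ∑ m, ∫ x, (Var[f; π | sigmaCompl m]) x ∂π := by
  obtain ⟨U, U₀, V, L, rfl, hU⟩ := h
  rcases hU.lam_le_one_or_subsingleton with hlam | hsub
  · exact GibbsSampler.mul_variance_le_of_boundedContinuous (fun m => sigmaCompl_le m)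
      (hU.mul_variance_le_of_boundedContinuous hlam hM) hf
  · have h0 : Var[f; gibbsMeasure U] = 0 := by
      have : f = fun _ => f 0 := funext fun x => congrArg f (Subsingleton.elim _ _)
      rw [this, variance_eq_integral aemeasurable_const]
      simp
    rw [h0, mul_zero]
    exact Finset.sum_nonneg fun m _ => integral_condVar_nonneg (sigmaCompl_le m) f

/-- Each block kernel acts as the orthogonal projection E[· | X_{-m}], and E f(f - E[f | X_{-m}]) is
the mean conditional variance. -/
theorem dirichletForm_gibbsKernel (π : Measure (State d)) [IsProbabilityMeasure π] (hM : 0 < M)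
    {f : State d → ℝ} (hf : MemLp f 2 π) :
    dirichletForm π (gibbsKernel π) f = (M : ℝ)⁻¹ *
      ∑ m, ∫ x, (Var[f; π | sigmaCompl m]) x ∂π := by
  have hfi := hf.integrable one_le_two
  have hM0 : (M : ℝ) ≠ 0 := by exact_mod_cast hM.ne'
  have hP : ∀ᵐ x ∂π, f x * (f x - ∫ y, f y ∂gibbsKernel π x) = (M : ℝ)⁻¹ *
      ∑ m, (f x ^ 2 -
        f x * (π[f | sigmaCompl m]) x) := by
    filter_upwards [ae_all_iff.2 fun m => ae_integrable_blockKernel m hfi,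
      ae_all_iff.2 fun m => blockAverage_ae_eq_condExp m hfi] with x h1 h2
    have h3 : gibbsKernel π x = (M : ℝ≥0∞)⁻¹ • ∑ m, blockKernel π m x := rfl
    rw [h3, integral_smul_measure, integral_finsetSum_measure fun m _ => h1 m]
    simp only [integral_blockKernel, h2]
    rw [Finset.sum_sub_distrib, ← Finset.mul_sum, Finset.sum_const, Finset.card_univ,
      Fintype.card_fin, nsmul_eq_mul, ENNReal.toReal_inv, ENNReal.toReal_natCast, smul_eq_mul]
    field_simp
  have h4 : ∀ m, Integrable (fun x => f x *
      (π[f | sigmaCompl m]) x) π := fun m =>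
    hf.integrable_mul (hf.condExp one_le_two)
  have h5 : ∀ m, Integrable (fun x => f x ^ 2 - f x * (π[f | sigmaCompl m]) x) π := fun m =>
    hf.integrable_sq.sub (h4 m)
  rw [dirichletForm, integral_congr_ae hP, integral_const_mul,
    integral_finsetSum _ fun m _ => h5 m]
  congr 1
  refine Finset.sum_congr rfl fun m _ => ?_
  rw [integral_condVar_eq_sub (sigmaCompl_le m) hf,
    ← integral_mul_condExp (sigmaCompl_le m) hf]
  exact integral_sub hf.integrable_sq (h4 m)

end SpectralGap

end GibbsSampler

/-! ### The spectral gap bound -/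

theorem mainTheorem5 {M : ℕ} (hM : 0 < M) (d : Fin M → ℕ)
    (π : Measure (GibbsSampler.State d)) [IsProbabilityMeasure π] (lam : ℝ)
    (hπ : GibbsSampler.BlockAssumption π lam) :
    ((1 / (2 * GibbsSampler.coordCondNumber lam * M) : ℝ) : EReal) ≤
        GibbsSampler.spectralGap π (GibbsSampler.gibbsKernel π) ∧
      ∀ (Ω : Type*) [MeasurableSpace Ω] (μ : Measure Ω) [IsProbabilityMeasure μ]
        (X : Ω → GibbsSampler.State d), Measurable X → μ.map X = π →
        ∀ f : GibbsSampler.State d → ℝ, MemLp f 2 π →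
          1 / (2 * GibbsSampler.coordCondNumber lam) * Var[fun ω => f (X ω); μ] ≤
            ∑ m, ∫ ω, (Var[fun ω => f (X ω); μ | GibbsSampler.sigmaDrop X m]) ω ∂μ := by
  have hlam : 0 < lam := by
    obtain ⟨U, U₀, V, L, -, hU⟩ := hπ
    exact hU.lam_pos
  have hκ : 1 / (2 * GibbsSampler.coordCondNumber lam) = lam / 2 := by
    rw [GibbsSampler.coordCondNumber]
    field_simp
  -- The claimed constant is lam / 2, so a factor 2 is given away here.
  have hhalf : ∀ v : ℝ, 0 ≤ v → lam / 2 * v ≤ lam * v := fun v hv => by nlinarith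
  refine ⟨?_, ?_⟩
  · refine le_iInf₂ fun f hf => le_iInf fun hvar => EReal.coe_le_coe_iff.2 ?_
    rw [GibbsSampler.dirichletForm_gibbsKernel π hM hf, le_div_iff₀ hvar, ← one_div_mul_one_div, hκ,
      one_div, mul_comm (lam / 2), mul_assoc]
    gcongr
    exact (hhalf _ hvar.le).trans (hπ.mul_variance_le hM hf)
  · intro Ω _ μ _ X hX hmap f hf
    subst hmap
    have h1 : ∀ m, ∫ ω, (Var[fun ω => f (X ω); μ | GibbsSampler.sigmaDrop X m]) ω ∂μ =
        ∫ x, (Var[f; μ.map X |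
          GibbsSampler.sigmaCompl m]) x ∂μ.map X := by
      intro m
      rw [← GibbsSampler.integral_condVar_comap hX (GibbsSampler.sigmaCompl_le m)
        (hf.integrable one_le_two), MeasurableSpace.comap_comp]
      rfl
    have h2 : Var[fun ω => f (X ω); μ] = Var[f; μ.map X] :=
      (variance_map hf.aestronglyMeasurable.aemeasurable hX.aemeasurable).symm
    simp only [h1]
    rw [hκ, h2]
    exact (hhalf _ (variance_nonneg _ _)).trans (hπ.mul_variance_le hM hf)
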